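/- Let $n>0$ be an integer, let $P=\mathbb{C}\{z_1,\dots,z_n\}$ be the ring of convergent complex power series in $n$ variables, let $\mathfrak m=(z_1,\dots,z_n)$ be its maximal ideal, let $I\subset P$ be a proper ideal, and let $R=P/I$. Let $$J=\Bigl\{f\in I\ \Bigm|\ \frac{\partial f}{\partial z_i}\in I\ \text{ for all } i=1,\dots,n\Bigr\},$$ which is an ideal of $P$. Then $I/(J+\mathfrak m I)$ is a finite-dimensional complex vector space and $$\dim R\ \ge\ n-\dim_{\mathbb C}\frac{I}{J+\mathfrak m I},$$ where $\dim R$ is the Krull dimension of $R$. -/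

import Mathlib

namespace ConvergentPowerSeries

/-- A complex power series `∑ a_d z^d` in `n` variables is convergent if it converges absolutely
on some polydisc `{|z_i| ≤ r}` with `r > 0`. -/
def IsConvergent {n : ℕ} (f : MvPowerSeries (Fin n) ℂ) : Prop :=
  ∃ r : ℝ, 0 < r ∧ Summable fun d : Fin n →₀ ℕ => ‖MvPowerSeries.coeff d f‖ * r ^ d.degree

theorem summable_of_le {n : ℕ} {f : MvPowerSeries (Fin n) ℂ} {r s : ℝ} (hr : 0 ≤ r) (hrs : r ≤ s)
    (h : Summable fun d : Fin n →₀ ℕ => ‖MvPowerSeries.coeff d f‖ * s ^ d.degree) :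
    Summable fun d : Fin n →₀ ℕ => ‖MvPowerSeries.coeff d f‖ * r ^ d.degree :=
  h.of_nonneg_of_le (fun d => by positivity) (fun d => by gcongr)

theorem isConvergent_C {n : ℕ} (a : ℂ) :
    IsConvergent (MvPowerSeries.C a : MvPowerSeries (Fin n) ℂ) := by
  classical
  refine ⟨1, one_pos, summable_of_ne_finset_zero (s := {0}) fun d hd => ?_⟩
  rw [Finset.mem_singleton] at hd
  simp [MvPowerSeries.coeff_C, hd]

theorem isConvergent_X {n : ℕ} (i : Fin n) :
    IsConvergent (MvPowerSeries.X i : MvPowerSeries (Fin n) ℂ) := by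
  classical
  refine ⟨1, one_pos, summable_of_ne_finset_zero (s := {Finsupp.single i 1}) fun d hd => ?_⟩
  rw [Finset.mem_singleton] at hd
  simp [MvPowerSeries.coeff_X, hd]

theorem IsConvergent.add {n : ℕ} {f g : MvPowerSeries (Fin n) ℂ}
    (hf : IsConvergent f) (hg : IsConvergent g) : IsConvergent (f + g) := by
  obtain ⟨r, hr, hf⟩ := hf
  obtain ⟨s, hs, hg⟩ := hg
  have h0 : 0 < min r s := lt_min hr hs
  refine ⟨min r s, h0, ((summable_of_le h0.le (min_le_left _ _) hf).add
    (summable_of_le h0.le (min_le_right _ _) hg)).of_nonneg_of_le (fun d => by positivity)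
    fun d => ?_⟩
  rw [map_add, ← add_mul]
  gcongr
  exact norm_add_le _ _

theorem IsConvergent.mul {n : ℕ} {f g : MvPowerSeries (Fin n) ℂ}
    (hf : IsConvergent f) (hg : IsConvergent g) : IsConvergent (f * g) := by
  classical
  obtain ⟨r, hr, hf⟩ := hf
  obtain ⟨s, hs, hg⟩ := hg
  have h0 : 0 < min r s := lt_min hr hs
  replace hf := summable_of_le h0.le (min_le_left r s) hf
  replace hg := summable_of_le h0.le (min_le_right r s) hg
  refine ⟨min r s, h0, ?_⟩
  set t : ℝ := min r s
  set F : (Fin n →₀ ℕ) → ℝ := fun d => ‖MvPowerSeries.coeff d f‖ * t ^ d.degree with hF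
  set G : (Fin n →₀ ℕ) → ℝ := fun d => ‖MvPowerSeries.coeff d g‖ * t ^ d.degree with hG
  have hFG : Summable fun p : (Fin n →₀ ℕ) × (Fin n →₀ ℕ) => F p.1 * G p.2 :=
    hf.mul_of_nonneg hg (fun d => by positivity) (fun d => by positivity)
  have hprod := summable_sum_mul_antidiagonal_of_summable_mul hFG
  refine hprod.of_nonneg_of_le (fun d => by positivity) fun d => ?_
  rw [MvPowerSeries.coeff_mul]
  refine (mul_le_mul_of_nonneg_right (norm_sum_le _ _) (by positivity)).trans (le_of_eq ?_)
  rw [Finset.sum_mul]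
  refine Finset.sum_congr rfl fun p hp => ?_
  rw [← Finset.HasAntidiagonal.mem_antidiagonal.mp hp, map_add, pow_add, norm_mul]
  simp only [hF, hG]
  ring

theorem IsConvergent.pderiv {n : ℕ} {f : MvPowerSeries (Fin n) ℂ} (hf : IsConvergent f)
    (i : Fin n) : IsConvergent (MvPowerSeries.pderiv ℂ i f) := by
  obtain ⟨r, hr, hf⟩ := hf
  refine ⟨r / 2, by positivity, ?_⟩
  have h1 := (hf.comp_injective (add_left_injective (Finsupp.single i 1))).mul_right r⁻¹
  refine h1.of_nonneg_of_le (fun d => by positivity) fun d => ?_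
  have h2 : ((d i : ℝ) + 1) ≤ 2 ^ d.degree := by
    have h3 : d i + 1 ≤ 2 ^ d.degree :=
      (Nat.succ_le_of_lt (Nat.lt_two_pow_self)).trans
        (Nat.pow_le_pow_right (by norm_num) (Finsupp.le_degree i d))
    exact_mod_cast h3
  have h4 : ‖((d i : ℂ) + 1)‖ = (d i : ℝ) + 1 := by
    have h5 := Complex.norm_natCast (d i + 1)
    push_cast at h5
    exact h5
  rw [MvPowerSeries.coeff_pderiv, norm_mul, h4]
  simp only [Function.comp_apply, map_add, Finsupp.degree_single, pow_succ]
  calc ‖MvPowerSeries.coeff (d + Finsupp.single i 1) f‖ * ((d i : ℝ) + 1) * (r / 2) ^ d.degree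
      ≤ ‖MvPowerSeries.coeff (d + Finsupp.single i 1) f‖ * 2 ^ d.degree * (r / 2) ^ d.degree := by
        gcongr
    _ = ‖MvPowerSeries.coeff (d + Finsupp.single i 1) f‖ * (r ^ d.degree * r) * r⁻¹ := by
        rw [div_pow]
        field_simp

/-- The convergent power series form a subalgebra of the algebra of formal power series. -/
noncomputable def subalgebra (n : ℕ) : Subalgebra ℂ (MvPowerSeries (Fin n) ℂ) where
  carrier := {f | IsConvergent f}
  mul_mem' := IsConvergent.mul
  add_mem' := IsConvergent.add
  algebraMap_mem' := isConvergent_C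

end ConvergentPowerSeries

/-- The `ℂ`-algebra `ℂ{z_1, …, z_n}` of convergent power series. -/
def ConvergentPowerSeries (n : ℕ) : Type := ↥(ConvergentPowerSeries.subalgebra n)

namespace ConvergentPowerSeries

noncomputable instance (n : ℕ) : CommRing (ConvergentPowerSeries n) :=
  inferInstanceAs (CommRing ↥(subalgebra n))

noncomputable instance (n : ℕ) : Algebra ℂ (ConvergentPowerSeries n) :=
  inferInstanceAs (Algebra ℂ ↥(subalgebra n))

/-- The coordinate `z_i`. -/
noncomputable def coord {n : ℕ} (i : Fin n) : ConvergentPowerSeries n :=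
  ⟨MvPowerSeries.X i, isConvergent_X i⟩

/-- The partial derivative `∂f/∂z_i` of a convergent power series. -/
noncomputable def partialDeriv {n : ℕ} (i : Fin n) (f : ConvergentPowerSeries n) :
    ConvergentPowerSeries n :=
  ⟨MvPowerSeries.pderiv ℂ i f.1, IsConvergent.pderiv f.2 i⟩

theorem partialDeriv_zero {n : ℕ} (i : Fin n) :
    partialDeriv i (0 : ConvergentPowerSeries n) = 0 :=
  Subtype.ext (map_zero (MvPowerSeries.pderiv ℂ i))

theorem partialDeriv_add {n : ℕ} (i : Fin n) (f g : ConvergentPowerSeries n) :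
    partialDeriv i (f + g) = partialDeriv i f + partialDeriv i g :=
  Subtype.ext (map_add (MvPowerSeries.pderiv ℂ i) f.1 g.1)

theorem partialDeriv_mul {n : ℕ} (i : Fin n) (f g : ConvergentPowerSeries n) :
    partialDeriv i (f * g) = f * partialDeriv i g + g * partialDeriv i f :=
  Subtype.ext ((MvPowerSeries.pderiv ℂ i).leibniz f.1 g.1)

/-- The ideal `𝔪 = (z_1, …, z_n)` of `ℂ{z_1, …, z_n}`. -/
noncomputable def maxIdeal (n : ℕ) : Ideal (ConvergentPowerSeries n) :=
  Ideal.span (Set.range coord)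

/-- The ideal `J = {f ∈ I | ∂f/∂z_i ∈ I for all i}` attached to an ideal `I`. -/
noncomputable def derivIdeal {n : ℕ} (I : Ideal (ConvergentPowerSeries n)) :
    Ideal (ConvergentPowerSeries n) where
  carrier := {f | f ∈ I ∧ ∀ i : Fin n, partialDeriv i f ∈ I}
  zero_mem' := ⟨I.zero_mem, fun i => by rw [partialDeriv_zero]; exact I.zero_mem⟩
  add_mem' := fun hf hg => ⟨I.add_mem hf.1 hg.1, fun i => by
    rw [partialDeriv_add]; exact I.add_mem (hf.2 i) (hg.2 i)⟩
  smul_mem' := fun g f hf => ⟨I.mul_mem_left g hf.1, fun i => by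
    rw [smul_eq_mul, partialDeriv_mul]
    exact I.add_mem (I.mul_mem_left _ (hf.2 i)) (I.mul_mem_right _ hf.1)⟩

/-- The quotient `I / (J + 𝔪 I)`, a complex vector space. -/
abbrev ObstructionQuotient {n : ℕ} (I : Ideal (ConvergentPowerSeries n)) : Type :=
  ↥I ⧸ (derivIdeal I ⊔ maxIdeal n * I).submoduleOf I

end ConvergentPowerSeries

/-! Write `P` for the ring and `𝔪` for its maximal ideal. Lift a basis of `I/(J + 𝔪I)` to a finite
set `s ⊆ I` generating an ideal `F`; Nakayama gives `I ≤ F + J`. The core claim,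
`le_radical_of_le_sup_derivIdeal`, is `I ≤ √F`. Then `dim P/F ≤ dim P/I`, while passing from `P`, of
dimension at least `n`, to `P/F` loses at most one dimension per element of `s`.

The claim is tested on arcs (`false_of_arc`). If `a ∈ I` is not in `√F`, some arc kills `F` and
gives `a` a finite order. Let `m` be the least order of an element of `I` along it. An element of
order `m` differs by an element of `F` from some `j ∈ J`, again of order `m`, and `m > 0` because `I
≤ 𝔪`. In characteristic zero the derivative of `j` along the arc has order `m - 1`; by the chain
rule it is a combination of the `∂j/∂z_i ∈ I`, so its order is at least `m`, a contradiction.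

The arc comes from a prime `q ⊇ F` maximal among ideals avoiding the powers of `a`. Then `P/q` is a
one-dimensional local domain, and a valuation ring dominating it is discrete with residue field `ℂ`
by a Krull–Akizuki argument. That `P` is Noetherian and local follows from a division theorem
(`exists_division`), whose convergence is controlled by weighted `ℓ¹`-norms. -/

namespace ConvergentPowerSeries

/-! ### A monomial order by prime weights -/

/-- The positive integer `∏ p_i ^ d_i` encoding the exponent `d`, where `p_i` is the `i`-th prime. -/
noncomputable def primeWeight {n : ℕ} (d : Fin n →₀ ℕ) : ℕ :=
  ∏ i : Fin n, Nat.nth Nat.Prime i ^ d i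

theorem primeWeight_pos {n : ℕ} (d : Fin n →₀ ℕ) : 0 < primeWeight d :=
  Finset.prod_pos fun i _ => pow_pos (Nat.prime_nth_prime i).pos _

theorem primeWeight_add {n : ℕ} (d e : Fin n →₀ ℕ) :
    primeWeight (d + e) = primeWeight d * primeWeight e := by
  simp [primeWeight, pow_add, Finset.prod_mul_distrib]

/-- Unique factorization. Comparing weights is thus a total order on exponents, compatible with
addition, with finitely many exponents below any given one. -/
theorem primeWeight_injective {n : ℕ} :
    Function.Injective (primeWeight : (Fin n →₀ ℕ) → ℕ) := by
  intro d e h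
  have key : ∀ (d : Fin n →₀ ℕ) (i : Fin n),
      (primeWeight d).factorization (Nat.nth Nat.Prime i) = d i := by
    intro d i
    rw [primeWeight, Nat.factorization_prod fun (j : Fin n) _ => pow_ne_zero (d j) (Nat.prime_nth_prime j).ne_zero,
      Finset.sum_apply', Finset.sum_eq_single i]
    · rw [(Nat.prime_nth_prime i).factorization_pow, Finsupp.single_eq_same]
    · intro j _ hj
      rw [(Nat.prime_nth_prime j).factorization_pow, Finsupp.single_eq_of_ne]
      intro h
      exact hj (Fin.ext (Nat.nth_injective Nat.infinite_setOfPred_prime h).symm)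
    · simp
  ext i
  rw [← key d i, ← key e i, h]

theorem two_pow_degree_le_primeWeight {n : ℕ} (d : Fin n →₀ ℕ) :
    2 ^ d.degree ≤ primeWeight d := by
  rw [Finsupp.degree_eq_sum, primeWeight, ← Finset.prod_pow_eq_pow_sum]
  exact Finset.prod_le_prod' fun i _ => Nat.pow_le_pow_left (Nat.prime_nth_prime i).two_le _

theorem primeWeight_le {n : ℕ} (d : Fin n →₀ ℕ) :
    primeWeight d ≤ Nat.nth Nat.Prime n ^ d.degree := by
  rw [Finsupp.degree_eq_sum, primeWeight, ← Finset.prod_pow_eq_pow_sum]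
  exact Finset.prod_le_prod' fun i _ => Nat.pow_le_pow_left
    (Nat.nth_monotone Nat.infinite_setOfPred_prime i.2.le) _

/-! ### Weighted norms adapted to the order -/

open scoped ENNReal NNReal

/-- The weight `(∏ p_i ^ d_i) ^ (-σ)`. -/
noncomputable def weight {n : ℕ} (σ : ℕ) (d : Fin n →₀ ℕ) : ℝ≥0 :=
  ((primeWeight d : ℝ≥0)⁻¹) ^ σ

theorem weight_add {n : ℕ} (σ : ℕ) (d e : Fin n →₀ ℕ) :
    weight σ (d + e) = weight σ d * weight σ e := by
  simp [weight, primeWeight_add, mul_pow, mul_comm]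

/-- The weighted `ℓ¹`-norm of a power series. -/
noncomputable def wnorm {n : ℕ} (σ : ℕ) (f : MvPowerSeries (Fin n) ℂ) : ℝ≥0∞ :=
  ∑' d, ‖MvPowerSeries.coeff d f‖ₑ * weight σ d

theorem wnorm_add_le {n : ℕ} (σ : ℕ) (f g : MvPowerSeries (Fin n) ℂ) :
    wnorm σ (f + g) ≤ wnorm σ f + wnorm σ g := by
  rw [wnorm, wnorm, wnorm, ← ENNReal.tsum_add]
  refine ENNReal.tsum_le_tsum fun d => ?_
  rw [map_add, ← add_mul]
  gcongr
  exact enorm_add_le _ _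

theorem wnorm_neg {n : ℕ} (σ : ℕ) (f : MvPowerSeries (Fin n) ℂ) : wnorm σ (-f) = wnorm σ f := by
  simp [wnorm]

theorem wnorm_zero {n : ℕ} (σ : ℕ) : wnorm σ (0 : MvPowerSeries (Fin n) ℂ) = 0 := by
  simp [wnorm]

theorem wnorm_sum_le {n : ℕ} (σ : ℕ) {ι : Type*} (s : Finset ι)
    (f : ι → MvPowerSeries (Fin n) ℂ) :
    wnorm σ (∑ i ∈ s, f i) ≤ ∑ i ∈ s, wnorm σ (f i) := by
  classical
  induction s using Finset.induction_on with
  | empty => simp [wnorm_zero]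
  | insert a s ha ih =>
    rw [Finset.sum_insert ha, Finset.sum_insert ha]
    exact (wnorm_add_le _ _ _).trans (by gcongr)

theorem wnorm_mul_le {n : ℕ} (σ : ℕ) (f g : MvPowerSeries (Fin n) ℂ) :
    wnorm σ (f * g) ≤ wnorm σ f * wnorm σ g := by
  classical
  have h : wnorm σ f * wnorm σ g = ∑' d : Fin n →₀ ℕ, ∑ p ∈ Finset.HasAntidiagonal.antidiagonal d,
      (‖MvPowerSeries.coeff p.1 f‖ₑ * weight σ p.1) *
        (‖MvPowerSeries.coeff p.2 g‖ₑ * weight σ p.2) := by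
    simp_rw [wnorm, ← ENNReal.tsum_mul_right, ← ENNReal.tsum_mul_left]
    rw [← ENNReal.tsum_prod (f := fun a b => (‖MvPowerSeries.coeff a f‖ₑ * weight σ a) *
        (‖MvPowerSeries.coeff b g‖ₑ * weight σ b)),
      ← Finset.HasAntidiagonal.sigmaAntidiagonalEquivProd.tsum_eq, ENNReal.tsum_sigma']
    refine tsum_congr fun d => ?_
    rw [tsum_fintype]
    exact Finset.sum_coe_sort (Finset.HasAntidiagonal.antidiagonal d) fun p =>
      (‖MvPowerSeries.coeff p.1 f‖ₑ * weight σ p.1) *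
        (‖MvPowerSeries.coeff p.2 g‖ₑ * weight σ p.2)
  rw [h, wnorm]
  refine ENNReal.tsum_le_tsum fun d => ?_
  rw [MvPowerSeries.coeff_mul]
  refine (mul_le_mul_left (enorm_sum_le _ _) _).trans (le_of_eq ?_)
  rw [Finset.sum_mul]
  refine Finset.sum_congr rfl fun p hp => ?_
  rw [← Finset.HasAntidiagonal.mem_antidiagonal.mp hp, weight_add, enorm_mul]
  push_cast
  ring

theorem isConvergent_of_wnorm_ne_top {n σ : ℕ} {f : MvPowerSeries (Fin n) ℂ}
    (h : wnorm σ f ≠ ⊤) : IsConvergent f := by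
  have h1 : Summable fun d => ‖MvPowerSeries.coeff d f‖₊ * weight σ d := by
    rw [← ENNReal.tsum_coe_ne_top_iff_summable]
    simpa [wnorm, enorm] using h
  have hM : (0 : ℝ) < (Nat.nth Nat.Prime n : ℝ) := by
    exact_mod_cast (Nat.prime_nth_prime n).pos
  -- Primes are indexed from 0, so the `n`-th one bounds all those used in the weight.
  refine ⟨((Nat.nth Nat.Prime n : ℝ)⁻¹) ^ σ, by positivity,
    (NNReal.summable_coe.mpr h1).of_nonneg_of_le (fun d => by positivity) fun d => ?_⟩
  simp only [NNReal.coe_mul, coe_nnnorm, weight, NNReal.coe_pow, NNReal.coe_inv,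
    NNReal.coe_natCast]
  rw [← pow_mul, mul_comm σ, pow_mul, inv_pow]
  have := primeWeight_pos d
  gcongr
  exact_mod_cast primeWeight_le d

theorem weight_anti {n : ℕ} {σ τ : ℕ} (h : σ ≤ τ) (d : Fin n →₀ ℕ) :
    weight τ d ≤ weight σ d := by
  refine pow_le_pow_of_le_one (zero_le) (inv_le_one_of_one_le₀ ?_) h
  exact_mod_cast primeWeight_pos d

theorem wnorm_anti {n : ℕ} {σ τ : ℕ} (h : σ ≤ τ) (f : MvPowerSeries (Fin n) ℂ) :
    wnorm τ f ≤ wnorm σ f :=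
  ENNReal.tsum_le_tsum fun d => by gcongr; exact weight_anti h d

theorem IsConvergent.exists_wnorm_ne_top {n : ℕ} {f : MvPowerSeries (Fin n) ℂ}
    (h : IsConvergent f) : ∃ σ, wnorm σ f ≠ ⊤ := by
  obtain ⟨r, hr, h⟩ := h
  obtain ⟨σ, hσ⟩ := exists_pow_lt_of_lt_one hr (show (2⁻¹ : ℝ) < 1 by norm_num)
  refine ⟨σ, ?_⟩
  have h1 : Summable fun d => ‖MvPowerSeries.coeff d f‖₊ * weight σ d := by
    rw [← NNReal.summable_coe]
    refine h.of_nonneg_of_le (fun d => by positivity) fun d => ?_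
    simp only [NNReal.coe_mul, coe_nnnorm, weight, NNReal.coe_pow, NNReal.coe_inv,
      NNReal.coe_natCast]
    have h2 : ((primeWeight d : ℝ)⁻¹) ≤ (2⁻¹) ^ d.degree := by
      rw [inv_pow]
      gcongr
      exact_mod_cast two_pow_degree_le_primeWeight d
    gcongr
    calc ((primeWeight d : ℝ)⁻¹) ^ σ ≤ ((2⁻¹) ^ d.degree) ^ σ := by gcongr
      _ = ((2⁻¹) ^ σ) ^ d.degree := by rw [← pow_mul, mul_comm, pow_mul]
      _ ≤ r ^ d.degree := by gcongr
  rw [← ENNReal.tsum_coe_ne_top_iff_summable] at h1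
  simpa [wnorm, enorm] using h1

theorem IsConvergent.eventually_wnorm_ne_top {n : ℕ} {f : MvPowerSeries (Fin n) ℂ}
    (h : IsConvergent f) : ∀ᶠ σ in Filter.atTop, wnorm σ f ≠ ⊤ := by
  obtain ⟨σ, hσ⟩ := h.exists_wnorm_ne_top
  filter_upwards [Filter.eventually_ge_atTop σ] with τ hτ
  exact ne_top_of_le_ne_top hσ (wnorm_anti hτ f)

/-- If all exponents of `u` come after `e`, then the norm of `u` becomes small compared with that
of `z ^ e`. -/
theorem IsConvergent.eventually_wnorm_le {n : ℕ} {u : MvPowerSeries (Fin n) ℂ}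
    (h : IsConvergent u) (e : Fin n →₀ ℕ)
    (hu : ∀ d, primeWeight d ≤ primeWeight e → MvPowerSeries.coeff d u = 0) :
    ∀ᶠ σ in Filter.atTop, wnorm σ u ≤ 2⁻¹ * weight σ e := by
  obtain ⟨σ₀, hσ₀⟩ := h.exists_wnorm_ne_top
  set E : ℝ≥0 := (primeWeight e : ℝ≥0) with hE
  have hE0 : 0 < E := by rw [hE]; exact_mod_cast primeWeight_pos e
  obtain ⟨A, hA⟩ : ∃ A : ℝ≥0, (A : ℝ≥0∞) = wnorm σ₀ u := WithTop.ne_top_iff_exists.mp hσ₀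
  -- Exponents occurring in `u` have weight at least `E + 1`: raising `σ` by `k` gains `(E + 1)⁻ᵏ`
  -- on `u`, but only `E⁻ᵏ` on `z ^ e`.
  have hbound : ∀ k, wnorm (σ₀ + k) u ≤ ((A * ((E + 1)⁻¹) ^ k : ℝ≥0) : ℝ≥0∞) := by
    intro k
    rw [ENNReal.coe_mul, hA, wnorm, wnorm, ← ENNReal.tsum_mul_right]
    refine ENNReal.tsum_le_tsum fun d => ?_
    by_cases hd : primeWeight d ≤ primeWeight e
    · simp [hu d hd]
    · rw [mul_assoc, ← ENNReal.coe_mul]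
      gcongr
      rw [weight, pow_add]
      refine mul_le_mul_right (pow_le_pow_left' (inv_anti₀ (by positivity) ?_) _) _
      rw [hE]
      exact_mod_cast not_le.mp hd
  have hlim : Filter.Tendsto (fun k : ℕ => A * (E * (E + 1)⁻¹) ^ k) Filter.atTop (nhds 0) := by
    have h1 : E * (E + 1)⁻¹ < 1 := by
      rw [← div_eq_mul_inv, div_lt_one (by positivity)]
      exact lt_add_one E
    simpa using (tendsto_pow_atTop_nhds_zero_of_lt_one (zero_le) h1).const_mul A
  have hev := hlim.eventually_le_const
    (show (0 : ℝ≥0) < 2⁻¹ * (E⁻¹) ^ σ₀ by positivity)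
  obtain ⟨K, hK⟩ := Filter.eventually_atTop.mp hev
  filter_upwards [Filter.eventually_ge_atTop (σ₀ + K)] with τ hτ
  obtain ⟨k, rfl⟩ := Nat.exists_eq_add_of_le ((Nat.le_add_right σ₀ K).trans hτ)
  refine (hbound k).trans ?_
  have h2 := hK k (by omega)
  have h3 : A * ((E + 1)⁻¹) ^ k ≤ 2⁻¹ * weight (σ₀ + k) e := by
    rw [weight, ← hE, pow_add, ← mul_assoc]
    calc A * ((E + 1)⁻¹) ^ k = (A * (E * (E + 1)⁻¹) ^ k) * (E⁻¹) ^ k := by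
          rw [mul_pow, mul_assoc, mul_right_comm, ← mul_pow, mul_inv_cancel₀ hE0.ne']
          ring
      _ ≤ _ := by gcongr
  have h4 : ((2⁻¹ : ℝ≥0) : ℝ≥0∞) = 2⁻¹ := by simp
  rw [← h4, ← ENNReal.coe_mul]
  exact_mod_cast h3

end ConvergentPowerSeries

/-! ### The division theorem -/

namespace ConvergentPowerSeries

open scoped ENNReal NNReal

/-- The series of the terms of `h` whose exponent is assigned to `i` by `c`, divided by
`z ^ e`. -/
noncomputable def assignedPart {n : ℕ} {ι : Type*} [DecidableEq ι] (c : (Fin n →₀ ℕ) → Option ι)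
    (e : ι → Fin n →₀ ℕ) (i : ι) (h : MvPowerSeries (Fin n) ℂ) : MvPowerSeries (Fin n) ℂ :=
  fun a => if c (a + e i) = some i then MvPowerSeries.coeff (a + e i) h else 0

theorem coeff_assignedPart {n : ℕ} {ι : Type*} [DecidableEq ι] (c : (Fin n →₀ ℕ) → Option ι)
    (e : ι → Fin n →₀ ℕ) (i : ι) (h : MvPowerSeries (Fin n) ℂ) (a : Fin n →₀ ℕ) :
    MvPowerSeries.coeff a (assignedPart c e i h) =
      if c (a + e i) = some i then MvPowerSeries.coeff (a + e i) h else 0 := rfl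

/-- Each exponent is assigned to at most one `i`, so the parts use disjoint sets of terms of `h`. -/
theorem sum_wnorm_assignedPart_le {n : ℕ} {ι : Type*} [DecidableEq ι] [Fintype ι]
    (c : (Fin n →₀ ℕ) → Option ι) (e : ι → Fin n →₀ ℕ) (h : MvPowerSeries (Fin n) ℂ) (σ : ℕ) :
    ∑ i, wnorm σ (assignedPart c e i h) * weight σ (e i) ≤ wnorm σ h := by
  have h1 : ∀ i, wnorm σ (assignedPart c e i h) * weight σ (e i) ≤
      ∑' d, if c d = some i then ‖MvPowerSeries.coeff d h‖ₑ * weight σ d else 0 := by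
    intro i
    refine le_trans (le_of_eq ?_)
      (ENNReal.tsum_comp_le_tsum_of_injective (add_left_injective (e i)) _)
    rw [wnorm, ← ENNReal.tsum_mul_right]
    refine tsum_congr fun a => ?_
    rw [coeff_assignedPart]
    by_cases ha : c (a + e i) = some i
    · simp [ha, weight_add, mul_assoc]
    · simp [ha]
  refine (Finset.sum_le_sum fun i _ => h1 i).trans ?_
  rw [← Summable.tsum_finsetSum fun _ _ => ENNReal.summable]
  refine ENNReal.tsum_le_tsum fun d => ?_
  rcases hd : c d with _ | j
  · simp
  · simp [Finset.sum_ite_eq]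

theorem finite_primeWeight_le (n X : ℕ) : {d : Fin n →₀ ℕ | primeWeight d ≤ X}.Finite :=
  (Set.finite_Iic X).preimage primeWeight_injective.injOn

/-- The terms of `h` with exponents of prime weight at most `X`. -/
noncomputable def weightTrunc {n : ℕ} (X : ℕ) (h : MvPowerSeries (Fin n) ℂ) :
    MvPowerSeries (Fin n) ℂ :=
  fun d => if primeWeight d ≤ X then MvPowerSeries.coeff d h else 0

theorem coeff_weightTrunc {n : ℕ} (X : ℕ) (h : MvPowerSeries (Fin n) ℂ) (d : Fin n →₀ ℕ) :
    MvPowerSeries.coeff d (weightTrunc X h) =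
      if primeWeight d ≤ X then MvPowerSeries.coeff d h else 0 := rfl

theorem wnorm_weightTrunc_ne_top {n : ℕ} (σ X : ℕ) (h : MvPowerSeries (Fin n) ℂ) :
    wnorm σ (weightTrunc X h) ≠ ⊤ := by
  rw [wnorm, tsum_eq_sum (s := (finite_primeWeight_le n X).toFinset)]
  · exact ENNReal.sum_ne_top.mpr fun d _ => ENNReal.mul_ne_top (by simp) (by simp)
  · intro d hd
    rw [coeff_weightTrunc, if_neg (by simpa using hd)]
    simp

theorem wnorm_le_of_forall_weightTrunc {n : ℕ} {σ : ℕ} {h : MvPowerSeries (Fin n) ℂ} {C : ℝ≥0∞}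
    (H : ∀ X, wnorm σ (weightTrunc X h) ≤ C) : wnorm σ h ≤ C := by
  rw [wnorm, ENNReal.tsum_eq_iSup_sum]
  refine iSup_le fun s => le_trans ?_ (H (s.sup primeWeight))
  refine le_trans (Finset.sum_le_sum fun d hd => ?_) (ENNReal.sum_le_tsum s)
  rw [coeff_weightTrunc, if_pos (Finset.le_sup hd)]

/-- The map `h ↦ g - ∑ Q_i(h) u_i`, whose fixed points solve the division problem. -/
noncomputable def divisionStep {n : ℕ} {ι : Type*} [DecidableEq ι] [Fintype ι]
    (c : (Fin n →₀ ℕ) → Option ι) (e : ι → Fin n →₀ ℕ) (u : ι → MvPowerSeries (Fin n) ℂ)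
    (g h : MvPowerSeries (Fin n) ℂ) : MvPowerSeries (Fin n) ℂ :=
  g - ∑ i, assignedPart c e i h * u i

/-- Multiplying by `u i` instead of `z ^ e i` strictly raises the weight, so a coefficient of the
step depends only on lighter coefficients of `h`. This permits solving the fixed point equation by
recursion. -/
theorem coeff_divisionStep_congr {n : ℕ} {ι : Type*} [DecidableEq ι] [Fintype ι]
    (c : (Fin n →₀ ℕ) → Option ι) (e : ι → Fin n →₀ ℕ) {u : ι → MvPowerSeries (Fin n) ℂ}
    (hu : ∀ i d, primeWeight d ≤ primeWeight (e i) → MvPowerSeries.coeff d (u i) = 0)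
    (g : MvPowerSeries (Fin n) ℂ) {h h' : MvPowerSeries (Fin n) ℂ} (d : Fin n →₀ ℕ)
    (H : ∀ d', primeWeight d' < primeWeight d →
      MvPowerSeries.coeff d' h = MvPowerSeries.coeff d' h') :
    MvPowerSeries.coeff d (divisionStep c e u g h) =
      MvPowerSeries.coeff d (divisionStep c e u g h') := by
  classical
  simp only [divisionStep, map_sub, map_sum, MvPowerSeries.coeff_mul]
  congr 1
  refine Finset.sum_congr rfl fun i _ => Finset.sum_congr rfl fun p hp => ?_
  by_cases hi : primeWeight p.2 ≤ primeWeight (e i)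
  · simp [hu i _ hi]
  · congr 1
    rw [coeff_assignedPart, coeff_assignedPart, H]
    rw [← Finset.HasAntidiagonal.mem_antidiagonal.mp hp, primeWeight_add, primeWeight_add]
    exact Nat.mul_lt_mul_of_pos_left (not_le.mp hi) (primeWeight_pos _)

theorem exists_divisionStep_fixed {n : ℕ} {ι : Type*} [DecidableEq ι] [Fintype ι]
    (c : (Fin n →₀ ℕ) → Option ι) (e : ι → Fin n →₀ ℕ) {u : ι → MvPowerSeries (Fin n) ℂ}
    (hu : ∀ i d, primeWeight d ≤ primeWeight (e i) → MvPowerSeries.coeff d (u i) = 0)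
    (g : MvPowerSeries (Fin n) ℂ) : ∃ h, divisionStep c e u g h = h := by
  let wf : WellFounded fun d d' : Fin n →₀ ℕ => primeWeight d < primeWeight d' :=
    (measure primeWeight).wf
  let F : ∀ d : Fin n →₀ ℕ, (∀ d', primeWeight d' < primeWeight d → ℂ) → ℂ := fun d h =>
    MvPowerSeries.coeff d (divisionStep c e u g
      (fun d' => if hd : primeWeight d' < primeWeight d then h d' hd else 0))
  let h : MvPowerSeries (Fin n) ℂ := fun d => wf.fix F d
  refine ⟨h, MvPowerSeries.ext fun d => ?_⟩
  have h1 : MvPowerSeries.coeff d h = F d fun d' _ => h d' := wf.fix_eq F d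
  rw [h1]
  refine coeff_divisionStep_congr c e hu g d fun d' hd' => ?_
  exact (dif_pos hd' (α := ℂ) (t := fun _ => h d') (e := fun _ => 0)).symm

/-- The step contracts by `1/2`, giving `‖h‖ ≤ ‖g‖ + ‖h‖/2`. Absorbing the last term needs a finite
norm, not yet known for the formal solution `h`; hence the passage through truncations. -/
theorem wnorm_le_of_divisionStep_fixed {n : ℕ} {ι : Type*} [DecidableEq ι] [Fintype ι]
    (c : (Fin n →₀ ℕ) → Option ι) (e : ι → Fin n →₀ ℕ) {u : ι → MvPowerSeries (Fin n) ℂ}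
    (hu : ∀ i d, primeWeight d ≤ primeWeight (e i) → MvPowerSeries.coeff d (u i) = 0)
    {g h : MvPowerSeries (Fin n) ℂ} (hh : divisionStep c e u g h = h) {σ : ℕ}
    (hσ : ∀ i, wnorm σ (u i) ≤ 2⁻¹ * weight σ (e i)) : wnorm σ h ≤ 2 * wnorm σ g := by
  refine wnorm_le_of_forall_weightTrunc fun X => ?_
  set t := weightTrunc X h with ht
  have h1 : wnorm σ t ≤ wnorm σ (divisionStep c e u g t) := by
    refine ENNReal.tsum_le_tsum fun d => ?_
    by_cases hd : primeWeight d ≤ X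
    · rw [coeff_divisionStep_congr c e hu g (h' := h), hh, ht, coeff_weightTrunc, if_pos hd]
      intro d' hd'
      rw [ht, coeff_weightTrunc, if_pos (hd'.le.trans hd)]
    · simp [ht, coeff_weightTrunc, hd]
  have h2 : wnorm σ (divisionStep c e u g t) ≤ wnorm σ g + 2⁻¹ * wnorm σ t := by
    rw [divisionStep, sub_eq_add_neg]
    refine (wnorm_add_le _ _ _).trans ?_
    rw [wnorm_neg]
    gcongr
    refine (wnorm_sum_le _ _ _).trans
      (le_trans ?_ (mul_le_mul_right (sum_wnorm_assignedPart_le c e t σ) _))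
    rw [Finset.mul_sum]
    refine Finset.sum_le_sum fun i _ => (wnorm_mul_le _ _ _).trans ?_
    refine (mul_le_mul_right (hσ i) _).trans (le_of_eq ?_)
    ring
  have h3 : wnorm σ t ≠ ⊤ := wnorm_weightTrunc_ne_top σ X h
  have h4 : 2⁻¹ * wnorm σ t + 2⁻¹ * wnorm σ t ≤ wnorm σ g + 2⁻¹ * wnorm σ t := by
    rw [← add_mul, ENNReal.inv_two_add_inv_two, one_mul]
    exact h1.trans h2
  have h5 := (ENNReal.add_le_add_iff_right (ENNReal.mul_ne_top (by simp) h3)).mp h4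
  calc wnorm σ t = 2 * (2⁻¹ * wnorm σ t) := by
        rw [← mul_assoc, ENNReal.mul_inv_cancel (by simp) (by simp), one_mul]
    _ ≤ _ := by gcongr

/-- Division of convergent power series by finitely many series with given initial exponents. -/
theorem exists_division {n : ℕ} {ι : Type*} [Fintype ι] (e : ι → Fin n →₀ ℕ)
    {f : ι → MvPowerSeries (Fin n) ℂ} (hf : ∀ i, IsConvergent (f i))
    (hf1 : ∀ i, MvPowerSeries.coeff (e i) (f i) = 1)
    (hf0 : ∀ i d, primeWeight d < primeWeight (e i) → MvPowerSeries.coeff d (f i) = 0)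
    {g : MvPowerSeries (Fin n) ℂ} (hg : IsConvergent g) :
    ∃ (q : ι → MvPowerSeries (Fin n) ℂ) (r : MvPowerSeries (Fin n) ℂ),
      (∀ i, IsConvergent (q i)) ∧ IsConvergent r ∧ g = ∑ i, q i * f i + r ∧
        ∀ d i, e i ≤ d → MvPowerSeries.coeff d r = 0 := by
  classical
  -- Each exponent divisible by some `e i` is assigned to one such `i`; the others form the
  -- remainder.
  obtain ⟨c, hc⟩ : ∃ c : (Fin n →₀ ℕ) → Option ι, ∀ d,
      (∀ i, c d = some i → e i ≤ d) ∧ (c d = none → ∀ i, ¬ e i ≤ d) := by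
    choose c hc using fun d : Fin n →₀ ℕ => show ∃ o : Option ι,
        (∀ i, o = some i → e i ≤ d) ∧ (o = none → ∀ i, ¬ e i ≤ d) by
      by_cases h : ∃ i, e i ≤ d
      · obtain ⟨i, hi⟩ := h
        exact ⟨some i, by rintro j ⟨⟩; exact hi, by rintro ⟨⟩⟩
      · exact ⟨none, by rintro j ⟨⟩, fun _ => not_exists.mp h⟩
    exact ⟨c, hc⟩
  set u : ι → MvPowerSeries (Fin n) ℂ := fun i => f i - MvPowerSeries.monomial (e i) 1 with hu_def
  have hu : ∀ i d, primeWeight d ≤ primeWeight (e i) → MvPowerSeries.coeff d (u i) = 0 := by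
    intro i d hd
    rcases hd.lt_or_eq with h | h
    · rw [hu_def, map_sub, hf0 i d h, MvPowerSeries.coeff_monomial, if_neg, sub_zero]
      rintro rfl
      exact h.ne rfl
    · rw [primeWeight_injective h, hu_def, map_sub, hf1, MvPowerSeries.coeff_monomial_same,
        sub_self]
  have hmon : ∀ i, IsConvergent (MvPowerSeries.monomial (e i) (-1) : MvPowerSeries (Fin n) ℂ) := by
    intro i
    refine ⟨1, one_pos, summable_of_ne_finset_zero (s := {e i}) fun d hd => ?_⟩
    rw [Finset.mem_singleton] at hd
    simp [MvPowerSeries.coeff_monomial, hd]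
  have huc : ∀ i, IsConvergent (u i) := by
    intro i
    have : u i = f i + MvPowerSeries.monomial (e i) (-1) := by
      rw [map_neg]
      exact sub_eq_add_neg _ _
    rw [this]
    exact (hf i).add (hmon i)
  obtain ⟨h, hh⟩ := exists_divisionStep_fixed c e hu g
  obtain ⟨σ, hσ1, hσ2⟩ := ((Filter.eventually_all.mpr fun i =>
    (huc i).eventually_wnorm_le (e i) (hu i)).and hg.eventually_wnorm_ne_top).exists
  have hσ : wnorm σ h ≠ ⊤ :=
    ne_top_of_le_ne_top (ENNReal.mul_ne_top (by simp) hσ2)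
      (wnorm_le_of_divisionStep_fixed c e hu hh hσ1)
  let r : MvPowerSeries (Fin n) ℂ := fun d => if c d = none then MvPowerSeries.coeff d h else 0
  have hr : ∀ d, MvPowerSeries.coeff d r =
    if c d = none then MvPowerSeries.coeff d h else 0 := fun d => rfl
  refine ⟨fun i => assignedPart c e i h, r, fun i => ?_, ?_, ?_, ?_⟩
  · refine isConvergent_of_wnorm_ne_top (σ := σ) fun htop => ?_
    have h1 := (Finset.single_le_sum (f := fun i => wnorm σ (assignedPart c e i h) *
      (weight σ (e i) : ℝ≥0∞)) (fun _ _ => zero_le) (Finset.mem_univ i)).trans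
      (sum_wnorm_assignedPart_le c e h σ)
    have h2 : (weight σ (e i) : ℝ≥0∞) ≠ 0 := by
      have := primeWeight_pos (e i)
      simp only [weight, ne_eq, ENNReal.coe_eq_zero]
      positivity
    simp only [htop, ENNReal.top_mul h2] at h1
    exact hσ (top_le_iff.mp h1)
  · refine isConvergent_of_wnorm_ne_top (σ := σ) (ne_top_of_le_ne_top hσ ?_)
    refine ENNReal.tsum_le_tsum fun d => ?_
    rw [hr]
    split_ifs
    · exact le_rfl
    · simp
  · have h1 : g = h + ∑ i, assignedPart c e i h * u i := by
      nth_rw 1 [← hh]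
      rw [divisionStep, sub_add_cancel]
    -- Sorting the terms of `h` by assignment; with the fixed point equation, the monomials and
    -- tails recombine into the `f i`.
    have h2 : h = r + ∑ i, assignedPart c e i h * MvPowerSeries.monomial (e i) 1 := by
      ext d
      rw [map_add, map_sum, hr]
      simp only [MvPowerSeries.coeff_mul_monomial, mul_one]
      have h3 : ∀ i, (if e i ≤ d then MvPowerSeries.coeff (d - e i) (assignedPart c e i h) else 0) =
          if c d = some i then MvPowerSeries.coeff d h else 0 := by
        intro i
        by_cases hi : e i ≤ d
        · rw [if_pos hi, coeff_assignedPart, tsub_add_cancel_of_le hi]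
        · rw [if_neg hi, if_neg fun h => hi ((hc d).1 i h)]
      rw [Finset.sum_congr rfl fun i _ => h3 i]
      rcases c d with _ | j <;> simp
    nth_rw 1 [h1, h2]
    rw [add_assoc, ← Finset.sum_add_distrib, add_comm]
    congr 1
    refine Finset.sum_congr rfl fun i _ => ?_
    rw [← mul_add, hu_def, add_sub_cancel]
  · intro d i hi
    rw [hr, if_neg fun h => (hc d).2 h i hi]

end ConvergentPowerSeries

/-! ### Noetherian and local structure, lower bound on the dimension -/

namespace ConvergentPowerSeries

variable {n : ℕ}

/-- The inclusion of convergent power series into formal power series. -/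
noncomputable def toMv (n : ℕ) : ConvergentPowerSeries n →ₐ[ℂ] MvPowerSeries (Fin n) ℂ :=
  (subalgebra n).val

theorem toMv_injective : Function.Injective (toMv n) := Subtype.val_injective

theorem toMv_coord (i : Fin n) : toMv n (coord i) = MvPowerSeries.X i := rfl

theorem toMv_partialDeriv (i : Fin n) (f : ConvergentPowerSeries n) :
    toMv n (partialDeriv i f) = MvPowerSeries.pderiv ℂ i (toMv n f) := rfl

theorem isConvergent_toMv (f : ConvergentPowerSeries n) : IsConvergent (toMv n f) := f.2

theorem exists_toMv_eq {f : MvPowerSeries (Fin n) ℂ} (hf : IsConvergent f) :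
    ∃ g, toMv n g = f := ⟨⟨f, hf⟩, rfl⟩

instance : IsDomain (ConvergentPowerSeries n) :=
  have := NoZeroDivisors.to_isDomain (MvPowerSeries (Fin n) ℂ)
  toMv_injective.isDomain (toMv n).toRingHom

theorem exists_eq_sum_mul_add {ι : Type*} [Fintype ι] (e : ι → Fin n →₀ ℕ)
    (f : ι → ConvergentPowerSeries n)
    (hf1 : ∀ i, MvPowerSeries.coeff (e i) (toMv n (f i)) = 1)
    (hf0 : ∀ i d, primeWeight d < primeWeight (e i) → MvPowerSeries.coeff d (toMv n (f i)) = 0)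
    (g : ConvergentPowerSeries n) :
    ∃ (q : ι → ConvergentPowerSeries n) (r : ConvergentPowerSeries n),
      g = ∑ i, q i * f i + r ∧ ∀ d i, e i ≤ d → MvPowerSeries.coeff d (toMv n r) = 0 := by
  obtain ⟨q, r, hq, hr, h, h0⟩ :=
    exists_division e (fun i => isConvergent_toMv (f i)) hf1 hf0 (isConvergent_toMv g)
  choose q' hq' using fun i => exists_toMv_eq (hq i)
  obtain ⟨r', rfl⟩ := exists_toMv_eq hr
  refine ⟨q', r', toMv_injective ?_, h0⟩
  rw [h, map_add, map_sum]
  simp only [map_mul, hq']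

theorem exists_initial_exponent {f : ConvergentPowerSeries n} (hf : f ≠ 0) :
    ∃ d, MvPowerSeries.coeff d (toMv n f) ≠ 0 ∧
      ∀ d', primeWeight d' < primeWeight d → MvPowerSeries.coeff d' (toMv n f) = 0 := by
  have hne : {d | MvPowerSeries.coeff d (toMv n f) ≠ 0}.Nonempty := by
    by_contra h
    rw [Set.not_nonempty_iff_eq_empty] at h
    refine hf (toMv_injective (MvPowerSeries.ext fun d => ?_))
    by_contra hd
    have : d ∈ {d | MvPowerSeries.coeff d (toMv n f) ≠ 0} := by simpa using hd
    rw [h] at this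
    exact this
  let wf := (measure (primeWeight (n := n))).wf
  refine ⟨wf.min _ hne, wf.min_mem _ hne, fun d' hd' => ?_⟩
  by_contra h
  exact wf.not_lt_min _ (x := d') h hd'

/-- Dickson's lemma: the minimal elements form an antichain, which is finite. -/
theorem exists_finite_le {α : Type*} [PartialOrder α] [WellQuasiOrderedLE α] (S : Set α) :
    ∃ E ⊆ S, E.Finite ∧ ∀ d ∈ S, ∃ e ∈ E, e ≤ d := by
  refine ⟨{d | Minimal (· ∈ S) d}, fun d hd => hd.prop, ?_, fun d hd => ?_⟩
  · exact WellQuasiOrderedLE.finite_of_isAntichain (setOfPred_minimal_antichain _)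
  · obtain ⟨m, hm, hmin⟩ := exists_minimal_le_of_wellFoundedLT (· ∈ S) d hd
    exact ⟨m, hmin, hm⟩

/-- The ring of convergent power series is Noetherian. -/
instance : IsNoetherianRing (ConvergentPowerSeries n) := by
  refine isNoetherianRing_iff_ideal_fg _ |>.mpr fun I => ?_
  -- The initial exponents of `I`. Elements realizing the minimal ones generate: a nonzero remainder
  -- in `I` would have its initial exponent in `S`, which division forbids.
  let S : Set (Fin n →₀ ℕ) := {d | ∃ f ∈ I, MvPowerSeries.coeff d (toMv n f) = 1 ∧
    ∀ d', primeWeight d' < primeWeight d → MvPowerSeries.coeff d' (toMv n f) = 0}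
  obtain ⟨E, hES, hE, hle⟩ := exists_finite_le S
  have := hE.fintype
  choose f hfI hf1 hf0 using fun e : E => hES e.2
  refine Submodule.fg_def.mpr ⟨Set.range f, Set.finite_range f, le_antisymm ?_ fun g hg => ?_⟩
  · exact Submodule.span_le.mpr (Set.range_subset_iff.mpr hfI)
  obtain ⟨q, r, rfl, hr⟩ := exists_eq_sum_mul_add (fun e : E => (e : Fin n →₀ ℕ)) f hf1 hf0 g
  have hq : ∑ i, q i * f i ∈ Ideal.span (Set.range f) :=
    sum_mem fun i _ => Ideal.mul_mem_left _ _ (Ideal.subset_span ⟨i, rfl⟩)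
  have hrI : r ∈ I := (Submodule.add_mem_iff_right _
    (sum_mem fun i _ => Ideal.mul_mem_left _ _ (hfI i))).mp hg
  suffices r = 0 by rw [this, add_zero]; exact hq
  by_contra hr0
  obtain ⟨d, hd, hd'⟩ := exists_initial_exponent hr0
  set c := MvPowerSeries.coeff d (toMv n r) with hc
  have hdS : d ∈ S := by
    refine ⟨c⁻¹ • r, Submodule.smul_of_tower_mem I c⁻¹ hrI, ?_, fun d' hlt => ?_⟩
    · rw [map_smul, map_smul, ← hc, smul_eq_mul, inv_mul_cancel₀ hd]
    · rw [map_smul, map_smul, hd' d' hlt, smul_zero]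
  obtain ⟨e, he, hed⟩ := hle d hdS
  exact hd (hr d ⟨e, he⟩ hed)

/-- The constant coefficient as an algebra homomorphism. -/
noncomputable def constCoeff (n : ℕ) : ConvergentPowerSeries n →ₐ[ℂ] ℂ :=
  { (MvPowerSeries.constantCoeff (σ := Fin n) (R := ℂ)).comp (toMv n).toRingHom with
    commutes' := fun a => by
      change MvPowerSeries.constantCoeff (toMv n (algebraMap ℂ _ a)) = a
      rw [AlgHom.commutes]
      exact MvPowerSeries.constantCoeff_C a }

theorem constCoeff_apply (f : ConvergentPowerSeries n) :
    constCoeff n f = MvPowerSeries.coeff 0 (toMv n f) := rfl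

/-- Divide `1` by the normalized `f`, of initial exponent 0: every exponent is at least 0, so there
is no remainder. -/
theorem isUnit_of_constCoeff_ne_zero {f : ConvergentPowerSeries n} (hf : constCoeff n f ≠ 0) :
    IsUnit f := by
  obtain ⟨q, r, h, hr⟩ := exists_eq_sum_mul_add (fun _ : Unit => (0 : Fin n →₀ ℕ))
    (fun _ => (constCoeff n f)⁻¹ • f)
    (fun _ => by
      rw [map_smul, map_smul, ← constCoeff_apply, smul_eq_mul, inv_mul_cancel₀ hf])
    (fun _ d hd => by
      have : primeWeight (0 : Fin n →₀ ℕ) = 1 := by simp [primeWeight]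
      have := primeWeight_pos d
      omega) 1
  have hr0 : r = 0 := toMv_injective (MvPowerSeries.ext fun d => by
    rw [hr d () (zero_le), map_zero, map_zero])
  rw [hr0, add_zero, Fintype.sum_unique] at h
  refine IsUnit.of_mul_eq_one ((constCoeff n f)⁻¹ • q default) ?_
  rw [mul_smul_comm, ← smul_mul_assoc, mul_comm, ← h]

instance : IsLocalRing (ConvergentPowerSeries n) :=
  IsLocalRing.of_isUnit_or_isUnit_one_sub_self fun f => by
    by_cases hf : constCoeff n f = 0
    · exact Or.inr (isUnit_of_constCoeff_ne_zero (by rw [map_sub, map_one, hf]; simp))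
    · exact Or.inl (isUnit_of_constCoeff_ne_zero hf)

theorem mem_maxIdeal_iff {f : ConvergentPowerSeries n} :
    f ∈ maxIdeal n ↔ constCoeff n f = 0 := by
  classical
  constructor
  · intro h
    refine (Ideal.span_le (I := RingHom.ker (constCoeff n).toRingHom)).mpr ?_ h
    rintro _ ⟨i, rfl⟩
    exact MvPowerSeries.constantCoeff_X i
  · intro h
    -- Division by the coordinates leaves only a constant as remainder.
    obtain ⟨q, r, rfl, hr⟩ := exists_eq_sum_mul_add (fun i : Fin n => Finsupp.single i 1) coord
      (fun i => by rw [toMv_coord, MvPowerSeries.coeff_index_single_self_X])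
      (fun i d hd => by
        rw [toMv_coord, MvPowerSeries.coeff_X, if_neg]
        rintro rfl
        exact hd.ne rfl) f
    have hq : ∑ i, q i * coord i ∈ maxIdeal n :=
      sum_mem fun i _ => Ideal.mul_mem_left _ _ (Ideal.subset_span ⟨i, rfl⟩)
    suffices r = 0 by rw [this, add_zero]; exact hq
    have hcq : constCoeff n (∑ i, q i * coord i) = 0 := by
      rw [map_sum]
      refine Finset.sum_eq_zero fun i _ => ?_
      have : constCoeff n (coord i) = 0 := MvPowerSeries.constantCoeff_X i
      rw [map_mul, this, mul_zero]
    rw [map_add, hcq, zero_add] at h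
    refine toMv_injective (MvPowerSeries.ext fun d => ?_)
    rw [map_zero, map_zero]
    by_cases hd : d = 0
    · rw [hd]
      exact h
    · obtain ⟨i, hi⟩ := Finsupp.ne_iff.mp hd
      refine hr d i (Finsupp.single_le_iff.mpr ?_)
      exact Nat.one_le_iff_ne_zero.mpr hi

theorem maxIdeal_eq : maxIdeal n = IsLocalRing.maximalIdeal (ConvergentPowerSeries n) := by
  ext f
  rw [mem_maxIdeal_iff, IsLocalRing.mem_maximalIdeal, mem_nonunits_iff]
  refine ⟨fun h hu => ?_, fun h => by_contra fun h' => h (isUnit_of_constCoeff_ne_zero h')⟩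
  exact (hu.map (constCoeff n)).ne_zero h

theorem sub_algebraMap_mem_maxIdeal (f : ConvergentPowerSeries n) :
    f - algebraMap ℂ _ (constCoeff n f) ∈ maxIdeal n := by
  rw [mem_maxIdeal_iff, map_sub, AlgHom.commutes]
  exact sub_self _

theorem hasSubst_killVars (i : ℕ) : MvPowerSeries.HasSubst fun j : Fin n =>
    if (j : ℕ) < i then 0 else (MvPowerSeries.X j : MvPowerSeries (Fin n) ℂ) :=
  MvPowerSeries.hasSubst_of_constantCoeff_zero fun j => by
    split_ifs
    · exact map_zero _
    · exact MvPowerSeries.constantCoeff_X j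

/-- The homomorphism setting the first `i` variables to zero. -/
noncomputable def killVars (n i : ℕ) : MvPowerSeries (Fin n) ℂ →ₐ[ℂ] MvPowerSeries (Fin n) ℂ :=
  MvPowerSeries.substAlgHom (hasSubst_killVars i)

theorem killVars_X (i : ℕ) (j : Fin n) : killVars n i (MvPowerSeries.X j) =
    if (j : ℕ) < i then 0 else MvPowerSeries.X j :=
  MvPowerSeries.substAlgHom_X (hasSubst_killVars i) j

theorem killVars_killVars (i : ℕ) (f : MvPowerSeries (Fin n) ℂ) :
    killVars n (i + 1) (killVars n i f) = killVars n (i + 1) f := by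
  have h : (fun j : Fin n => MvPowerSeries.subst (fun j : Fin n => if (j : ℕ) < i + 1 then 0 else
      (MvPowerSeries.X j : MvPowerSeries (Fin n) ℂ)) (if (j : ℕ) < i then 0 else
      (MvPowerSeries.X j : MvPowerSeries (Fin n) ℂ))) = fun j : Fin n =>
      if (j : ℕ) < i + 1 then 0 else (MvPowerSeries.X j : MvPowerSeries (Fin n) ℂ) := by
    funext j
    rw [← MvPowerSeries.substAlgHom_apply (R := ℂ) (hasSubst_killVars (i + 1))]
    by_cases hj : (j : ℕ) < i
    · rw [if_pos hj, map_zero, if_pos (by omega)]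
    · rw [if_neg hj]
      exact killVars_X (i + 1) j
  rw [killVars, killVars, MvPowerSeries.substAlgHom_apply, MvPowerSeries.substAlgHom_apply,
    MvPowerSeries.subst_comp_subst_apply (hasSubst_killVars i) (hasSubst_killVars (i + 1)), h,
    MvPowerSeries.substAlgHom_apply]

/-- The prime ideal `(z_1, …, z_i)`, as the kernel of setting these variables to zero. -/
noncomputable def varsPrime (n i : ℕ) : PrimeSpectrum (ConvergentPowerSeries n) :=
  ⟨RingHom.ker ((killVars n i).comp (toMv n)),
    have := NoZeroDivisors.to_isDomain (MvPowerSeries (Fin n) ℂ)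
    RingHom.ker_isPrime _⟩

theorem mem_varsPrime {i : ℕ} {f : ConvergentPowerSeries n} :
    f ∈ (varsPrime n i).asIdeal ↔ killVars n i (toMv n f) = 0 := Iff.rfl

theorem varsPrime_lt (i : Fin n) : varsPrime n i < varsPrime n (i + 1) := by
  refine lt_of_le_of_ne (fun f hf => ?_) fun h => ?_
  · replace hf := mem_varsPrime.mp hf
    refine mem_varsPrime.mpr ?_
    rw [← killVars_killVars, hf, map_zero]
  · have h1 : coord i ∈ (varsPrime n (i + 1)).asIdeal := by
      rw [mem_varsPrime, toMv_coord, killVars_X, if_pos (Nat.lt_succ_self _)]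
    rw [← h, mem_varsPrime, toMv_coord, killVars_X, if_neg (lt_irrefl _)] at h1
    simpa using congrArg (MvPowerSeries.coeff (Finsupp.single i 1)) h1

/-- The chain `0 < (z_1) < … < (z_1, …, z_n)`. Being kernels of maps to a domain, its members are
visibly prime. -/
theorem le_ringKrullDim (n : ℕ) : (n : WithBot ℕ∞) ≤ ringKrullDim (ConvergentPowerSeries n) :=
  Order.LTSeries.length_le_krullDim
    { length := n
      toFun := fun i => varsPrime n i
      step := fun i => varsPrime_lt i }

end ConvergentPowerSeries

/-! ### Polynomial arcs and the chain rule -/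

theorem PowerSeries.hasSubst_polynomial_X_mul {n : ℕ} (s : Fin n → Polynomial ℂ) :
    MvPowerSeries.HasSubst fun i => ((Polynomial.X * s i : Polynomial ℂ) : PowerSeries ℂ) :=
  MvPowerSeries.hasSubst_of_constantCoeff_zero fun i => by
    change PowerSeries.constantCoeff _ = 0
    simp

/-- A nonzero complex constant is a unit and `t` is not, so the constant term must vanish; cancel
`t` and repeat. This carries orders from `V` to `ℂ[X]`. -/
theorem Polynomial.X_pow_dvd_of_pow_dvd_aeval {V : Type*} [CommRing V] [IsDomain V] [Algebra ℂ V]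
    {t : V} (ht0 : t ≠ 0) (ht : ¬ IsUnit t) (N : ℕ) (s : Polynomial ℂ)
    (h : t ^ N ∣ Polynomial.aeval t s) : (Polynomial.X : Polynomial ℂ) ^ N ∣ s := by
  induction N generalizing s with
  | zero => simp
  | succ N ih =>
    have h0 : s.coeff 0 = 0 := by
      by_contra hc
      have h1 : t ∣ Polynomial.aeval t s := (dvd_pow_self t N.succ_ne_zero).trans h
      rw [← Polynomial.divX_mul_X_add s, map_add, map_mul, Polynomial.aeval_X,
        dvd_add_right (dvd_mul_left _ _), Polynomial.aeval_C] at h1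
      exact ht (isUnit_of_dvd_unit h1 ((IsUnit.mk0 _ hc).map (algebraMap ℂ V)))
    obtain ⟨s', rfl⟩ := Polynomial.X_dvd_iff.mpr h0
    rw [map_mul, Polynomial.aeval_X, pow_succ', mul_dvd_mul_iff_left ht0] at h
    rw [pow_succ']
    exact mul_dvd_mul_left _ (ih s' h)

theorem exists_polynomial_pow_dvd_sub {V : Type*} [CommRing V] [Algebra ℂ V] {t : V}
    (hV : ∀ v, ∃ (c : ℂ) (w : V), v = algebraMap ℂ V c + t * w) (N : ℕ) (v : V) :
    ∃ s : Polynomial ℂ, t ^ N ∣ v - Polynomial.aeval t s := by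
  induction N generalizing v with
  | zero => exact ⟨0, by simp⟩
  | succ N ih =>
    obtain ⟨c, w, rfl⟩ := hV v
    obtain ⟨s, hs⟩ := ih w
    refine ⟨Polynomial.C c + Polynomial.X * s, ?_⟩
    rw [map_add, map_mul, Polynomial.aeval_C, Polynomial.aeval_X, add_sub_add_left_eq_sub,
      ← mul_sub, pow_succ']
    exact mul_dvd_mul_left _ hs

namespace ConvergentPowerSeries

variable {n : ℕ}

theorem exists_eq_algebraMap_add_sum (f : ConvergentPowerSeries n) :
    ∃ (c : ℂ) (g : Fin n → ConvergentPowerSeries n),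
      f = algebraMap ℂ _ c + ∑ i, g i * coord i := by
  obtain ⟨g, hg⟩ := Ideal.mem_span_range_iff_exists_fun.mp (sub_algebraMap_mem_maxIdeal f)
  exact ⟨constCoeff n f, g, by rw [hg, add_sub_cancel]⟩

/-- The arc `z_i = X * s_i(X)`, as a homomorphism to formal power series in one variable. -/
noncomputable def arcHom (s : Fin n → Polynomial ℂ) :
    ConvergentPowerSeries n →ₐ[ℂ] PowerSeries ℂ :=
  (MvPowerSeries.substAlgHom (PowerSeries.hasSubst_polynomial_X_mul s)).comp (toMv n)

theorem arcHom_coord (s : Fin n → Polynomial ℂ) (i : Fin n) :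
    arcHom s (coord i) = ((Polynomial.X * s i : Polynomial ℂ) : PowerSeries ℂ) :=
  MvPowerSeries.substAlgHom_X (PowerSeries.hasSubst_polynomial_X_mul s) i

theorem X_dvd_arcHom_coord (s : Fin n → Polynomial ℂ) (i : Fin n) :
    PowerSeries.X ∣ arcHom s (coord i) := by
  rw [arcHom_coord, Polynomial.coe_mul, Polynomial.coe_X]
  exact dvd_mul_right _ _

theorem X_dvd_arcHom (s : Fin n → Polynomial ℂ) {f : ConvergentPowerSeries n}
    (hf : f ∈ maxIdeal n) : PowerSeries.X ∣ arcHom s f := by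
  obtain ⟨g, rfl⟩ := Ideal.mem_span_range_iff_exists_fun.mp hf
  rw [map_sum]
  refine Finset.dvd_sum fun i _ => ?_
  rw [map_mul]
  exact (X_dvd_arcHom_coord s i).mul_left _

theorem partialDeriv_algebraMap (i : Fin n) (c : ℂ) :
    partialDeriv i (algebraMap ℂ (ConvergentPowerSeries n) c) = 0 :=
  toMv_injective (by
    rw [toMv_partialDeriv, AlgHom.commutes, Derivation.map_algebraMap, map_zero])

theorem partialDeriv_coord (i j : Fin n) :
    partialDeriv i (coord j : ConvergentPowerSeries n) = if j = i then 1 else 0 :=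
  toMv_injective (by
    classical
    rw [toMv_partialDeriv, toMv_coord, MvPowerSeries.pderiv_X]
    split_ifs <;> simp_all)

/-- The defect of the chain rule along an arc. -/
noncomputable def chainDefect (s : Fin n → Polynomial ℂ) :
    ConvergentPowerSeries n →+ PowerSeries ℂ where
  toFun f := PowerSeries.derivative ℂ (arcHom s f) -
    ∑ i, arcHom s (partialDeriv i f) * PowerSeries.derivative ℂ (arcHom s (coord i))
  map_zero' := by simp [partialDeriv_zero]
  map_add' f g := by
    simp only [partialDeriv_add, map_add, add_mul, Finset.sum_add_distrib]
    ring

theorem chainDefect_apply (s : Fin n → Polynomial ℂ) (f : ConvergentPowerSeries n) :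
    chainDefect s f = PowerSeries.derivative ℂ (arcHom s f) -
      ∑ i, arcHom s (partialDeriv i f) * PowerSeries.derivative ℂ (arcHom s (coord i)) := rfl

theorem chainDefect_mul (s : Fin n → Polynomial ℂ) (f g : ConvergentPowerSeries n) :
    chainDefect s (f * g) = arcHom s f * chainDefect s g + arcHom s g * chainDefect s f := by
  simp only [chainDefect_apply, partialDeriv_mul, map_add, map_mul, Derivation.leibniz,
    add_mul, Finset.sum_add_distrib, smul_eq_mul, mul_sub, Finset.mul_sum, mul_assoc]
  ring

theorem chainDefect_algebraMap (s : Fin n → Polynomial ℂ) (c : ℂ) :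
    chainDefect s (algebraMap ℂ _ c) = 0 := by
  rw [chainDefect_apply, AlgHom.commutes, Derivation.map_algebraMap]
  simp [partialDeriv_algebraMap]

theorem chainDefect_coord (s : Fin n → Polynomial ℂ) (j : Fin n) :
    chainDefect s (coord j) = 0 := by
  rw [chainDefect_apply]
  simp [partialDeriv_coord, apply_ite (arcHom s), ite_mul]

/-- The defect is a derivation along the arc that vanishes on constants and coordinates. On `f = c +
∑ g_i z_i` it is `∑ arc(z_i) · defect(g_i)`, gaining a factor `X`; iterating, it is divisible by
every power of `X`. -/
theorem chainDefect_eq_zero (s : Fin n → Polynomial ℂ) (f : ConvergentPowerSeries n) :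
    chainDefect s f = 0 := by
  have h : ∀ M f, PowerSeries.X ^ M ∣ chainDefect s f := by
    intro M
    induction M with
    | zero => simp
    | succ M ih =>
      intro f
      obtain ⟨c, g, rfl⟩ := exists_eq_algebraMap_add_sum f
      rw [map_add, chainDefect_algebraMap, zero_add, map_sum]
      refine Finset.dvd_sum fun i _ => ?_
      rw [chainDefect_mul, chainDefect_coord, mul_zero, zero_add, pow_succ']
      exact mul_dvd_mul (X_dvd_arcHom_coord s i) (ih _)
  ext m
  rw [map_zero]
  exact PowerSeries.X_pow_dvd_iff.mp (h (m + 1) f) m (Nat.lt_succ_self m)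

/-- The chain rule along a polynomial arc. -/
theorem derivative_arcHom (s : Fin n → Polynomial ℂ) (f : ConvergentPowerSeries n) :
    PowerSeries.derivative ℂ (arcHom s f) =
      ∑ i, arcHom s (partialDeriv i f) * PowerSeries.derivative ℂ (arcHom s (coord i)) :=
  sub_eq_zero.mp (chainDefect_eq_zero s f)

/-! ### Comparing an arc in `V` with a polynomial arc -/

section Approximation

variable {V : Type*} [CommRing V] [Algebra ℂ V] {t : V}
  (φ : ConvergentPowerSeries n →ₐ[ℂ] V)

theorem dvd_map_coord (ht : ¬ IsUnit t)
    (hV : ∀ v, ∃ (c : ℂ) (w : V), v = algebraMap ℂ V c + t * w) (i : Fin n) :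
    t ∣ φ (coord i) := by
  obtain ⟨c, w, h⟩ := hV (φ (coord i))
  by_cases hc : c = 0
  · rw [h, hc, map_zero, zero_add]
    exact dvd_mul_right _ _
  · refine absurd ?_ ht
    -- With `c ≠ 0`, this unit would map to the multiple `t * w` of a nonunit.
    have hu : IsUnit (coord i - algebraMap ℂ (ConvergentPowerSeries n) c) := by
      refine isUnit_of_constCoeff_ne_zero ?_
      have h1 : constCoeff n (coord i) = 0 := MvPowerSeries.constantCoeff_X i
      rw [map_sub, h1, AlgHom.commutes]
      simpa using hc
    have h2 := hu.map φ
    rw [map_sub, h, AlgHom.commutes, add_sub_cancel_left] at h2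
    exact isUnit_of_mul_isUnit_left h2

/-- One polynomial approximates `f` along both arcs. Writing `f = c + ∑ g_i z_i` gains one order of
precision per step, so no continuity of `φ` is required. -/
theorem exists_polynomial_approx (s : Fin n → Polynomial ℂ) {N : ℕ}
    (hs : ∀ i, t ^ N ∣ φ (coord i) - Polynomial.aeval t (Polynomial.X * s i))
    (ht : ∀ i, t ∣ φ (coord i)) (f : ConvergentPowerSeries n) :
    ∃ p : Polynomial ℂ, t ^ N ∣ φ f - Polynomial.aeval t p ∧
      PowerSeries.X ^ N ∣ arcHom s f - (p : PowerSeries ℂ) := by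
  have key : ∀ M ≤ N, ∀ f, ∃ p : Polynomial ℂ, t ^ M ∣ φ f - Polynomial.aeval t p ∧
      PowerSeries.X ^ M ∣ arcHom s f - (p : PowerSeries ℂ) := by
    intro M
    induction M with
    | zero => exact fun _ f => ⟨0, by simp, by simp⟩
    | succ M ih =>
      intro hM f
      obtain ⟨c, g, rfl⟩ := exists_eq_algebraMap_add_sum f
      choose p hp hp' using fun i => ih (by omega) (g i)
      refine ⟨Polynomial.C c + ∑ i, p i * (Polynomial.X * s i), ?_, ?_⟩
      · rw [map_add, map_add, AlgHom.commutes, Polynomial.aeval_C, add_sub_add_left_eq_sub,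
          map_sum, map_sum, ← Finset.sum_sub_distrib]
        refine Finset.dvd_sum fun i _ => ?_
        have h1 : φ (g i * coord i) - Polynomial.aeval t (p i * (Polynomial.X * s i)) =
            (φ (g i) - Polynomial.aeval t (p i)) * φ (coord i) + Polynomial.aeval t (p i) *
              (φ (coord i) - Polynomial.aeval t (Polynomial.X * s i)) := by
          rw [map_mul, map_mul]
          ring
        rw [h1]
        refine dvd_add ?_ (((pow_dvd_pow t hM).trans (hs i)).mul_left _)
        rw [pow_succ]
        exact mul_dvd_mul (hp i) (ht i)
      · have h2 : ((Polynomial.C c + ∑ i, p i * (Polynomial.X * s i) : Polynomial ℂ) :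
            PowerSeries ℂ) = algebraMap ℂ _ c + ∑ i, (p i : PowerSeries ℂ) * arcHom s (coord i) := by
          simp only [arcHom_coord, ← Polynomial.coe_mul]
          rw [Polynomial.coe_add, Polynomial.coe_C]
          congr 1
          rw [← Polynomial.coeToPowerSeries.ringHom_apply, map_sum]
          simp only [Polynomial.coeToPowerSeries.ringHom_apply]
        rw [h2, map_add, AlgHom.commutes, add_sub_add_left_eq_sub, map_sum,
          ← Finset.sum_sub_distrib]
        refine Finset.dvd_sum fun i _ => ?_
        rw [map_mul, ← sub_mul, pow_succ]
        exact mul_dvd_mul (hp' i) (X_dvd_arcHom_coord s i)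
  exact key N le_rfl f

/-- No arc can annihilate `F` without annihilating `I` if `I` is generated by `F` and the
elements of `I` whose derivatives lie in `I`. -/
theorem false_of_arc [IsDomain V] (ht0 : t ≠ 0) (ht : ¬ IsUnit t)
    (hV : ∀ v, ∃ (c : ℂ) (w : V), v = algebraMap ℂ V c + t * w)
    {I F : Ideal (ConvergentPowerSeries n)} (hI : I ≤ maxIdeal n) (hIF : I ≤ F ⊔ derivIdeal I)
    (hF : ∀ f ∈ F, φ f = 0) {a : ConvergentPowerSeries n} (ha : a ∈ I) {u : V} (hu : IsUnit u)
    {k : ℕ} (hau : φ a = u * t ^ k) : False := by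
  classical
  have hz := dvd_map_coord φ ht hV
  choose z hz' using hz
  -- Precision `k + 1` suffices: it still detects that `a` has order `k`.
  choose s hs using fun i => exists_polynomial_pow_dvd_sub hV (k + 1) (z i)
  replace hs : ∀ i, t ^ (k + 1) ∣ φ (coord i) - Polynomial.aeval t (Polynomial.X * s i) := by
    intro i
    rw [hz', map_mul, Polynomial.aeval_X, ← mul_sub]
    exact (hs i).mul_left _
  have happ := exists_polynomial_approx φ s hs (dvd_map_coord φ ht hV)
  have hFX : ∀ f ∈ F, PowerSeries.X ^ (k + 1) ∣ arcHom s f := by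
    intro f hf
    obtain ⟨p, hp, hp'⟩ := happ f
    rw [hF f hf, zero_sub, dvd_neg] at hp
    obtain ⟨p', rfl⟩ := Polynomial.X_pow_dvd_of_pow_dvd_aeval ht0 ht _ _ hp
    rw [Polynomial.coe_mul, Polynomial.coe_pow, Polynomial.coe_X] at hp'
    exact (dvd_sub_left (dvd_mul_right _ _)).mp hp'
  have haX : ∃ k' ≤ k, ∃ g ∈ I, ¬ (PowerSeries.X : PowerSeries ℂ) ^ (k' + 1) ∣ arcHom s g := by
    refine ⟨k, le_rfl, a, ha, fun h => ?_⟩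
    obtain ⟨p, hp, hp'⟩ := happ a
    rw [dvd_sub_right h, PowerSeries.X_pow_dvd_iff] at hp'
    obtain ⟨p', rfl⟩ := Polynomial.X_pow_dvd_iff.mpr fun d hd => by
      simpa using hp' d hd
    rw [map_mul, map_pow, Polynomial.aeval_X, dvd_sub_left (dvd_mul_right _ _), hau, pow_succ',
      mul_dvd_mul_iff_right (pow_ne_zero _ ht0)] at hp
    exact ht (isUnit_of_dvd_unit hp hu)
  -- The least order of an element of `I` along the polynomial arc, attained by `g`; it is at most
  -- `k`, below the order to which `F` vanishes.
  obtain ⟨hk, g, hg, hgX⟩ := Nat.find_spec haX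
  set m := Nat.find haX with hm
  have hmin : ∀ f ∈ I, PowerSeries.X ^ m ∣ arcHom s f := by
    intro f hf
    rcases Nat.eq_zero_or_pos m with h0 | h0
    · simp [h0]
    · by_contra h
      refine Nat.find_min haX (m := m - 1) (by omega) ⟨by omega, f, hf, ?_⟩
      rwa [Nat.sub_add_cancel h0]
  obtain ⟨f, hf, j, hj, rfl⟩ := Submodule.mem_sup.mp (hIF hg)
  rw [map_add, dvd_add_right ((pow_dvd_pow _ (by omega)).trans (hFX f hf))] at hgX
  refine hgX (PowerSeries.X_pow_dvd_iff.mpr fun d hd => ?_)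
  rcases (Nat.lt_succ_iff.mp hd).lt_or_eq with h | rfl
  · exact PowerSeries.X_pow_dvd_iff.mp (hmin j hj.1) d h
  · rcases Nat.eq_zero_or_pos m with h0 | h0
    · rw [h0, PowerSeries.coeff_zero_eq_constantCoeff]
      exact PowerSeries.X_dvd_iff.mp (X_dvd_arcHom s (hI hj.1))
    · have h1 : PowerSeries.X ^ m ∣ PowerSeries.derivative ℂ (arcHom s j) := by
        rw [derivative_arcHom]
        exact Finset.dvd_sum fun i _ => (hmin _ (hj.2 i)).mul_right _
      have h2 := PowerSeries.X_pow_dvd_iff.mp h1 (m - 1) (by omega)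
      rw [PowerSeries.coeff_derivative, Nat.sub_add_cancel h0] at h2
      refine (mul_eq_zero.mp h2).resolve_right ?_
      exact_mod_cast Nat.succ_ne_zero (m - 1)

end Approximation

end ConvergentPowerSeries

/-! ### One-dimensional local domains and discrete valuations -/

/-- In a Noetherian local domain in which a nonzero nonunit `a` lies in all nonzero primes, the
maximal ideal is nilpotent modulo `a`. -/
theorem IsLocalRing.exists_maximalIdeal_pow_le_span {B : Type*} [CommRing B] [IsDomain B]
    [IsNoetherianRing B] [IsLocalRing B] {a : B} (ha0 : a ≠ 0)
    (ha : ∀ p : Ideal B, p.IsPrime → p ≠ ⊥ → a ∈ p) :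
    ∃ M, IsLocalRing.maximalIdeal B ^ M ≤ Ideal.span {a} := by
  have key : IsLocalRing.maximalIdeal B ≤ (Ideal.span {a}).radical := by
    rw [← Ideal.sInf_minimalPrimes]
    refine le_sInf fun p hp => ?_
    have hpp := hp.isPrime
    by_contra hlt
    -- Prime avoidance gives a nonunit `x` outside all minimal primes of `a`. A minimal prime `Q` of
    -- `x` contains `a`, hence lies strictly above a nonzero prime, against Krull's bound `Q.height
    -- ≤ 1`.
    have hsub : ¬ ((IsLocalRing.maximalIdeal B : Set B) ⊆
        ⋃ q ∈ (Ideal.span {a}).minimalPrimes, (q : Set B)) := by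
      intro h
      rw [Ideal.subset_union_prime_finite
        ((Ideal.span {a}).finite_minimalPrimes_of_isNoetherianRing) p p
        (fun q hq _ _ => hq.isPrime)] at h
      obtain ⟨q, hq, hmq⟩ := h
      have hqm : q = IsLocalRing.maximalIdeal B :=
        le_antisymm (IsLocalRing.le_maximalIdeal hq.isPrime.ne_top) hmq
      have hpq : p ≤ q := hqm ▸ IsLocalRing.le_maximalIdeal hpp.ne_top
      exact hlt (hmq.trans (hq.2 hp.1 hpq))
    obtain ⟨x, hxm, hx⟩ := Set.not_subset.mp hsub
    simp only [Set.mem_iUnion, not_exists, SetLike.mem_coe] at hx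
    obtain ⟨Q, hQ⟩ := Ideal.nonempty_minimalPrimes (I := Ideal.span {x}) fun h =>
      (IsLocalRing.mem_maximalIdeal x).mp hxm (Ideal.span_singleton_eq_top.mp h)
    have hQp := hQ.isPrime
    have hxQ : x ∈ Q := hQ.1.2 (Ideal.mem_span_singleton_self x)
    have hx0 : x ≠ 0 := by
      rintro rfl
      exact hx p hp p.zero_mem
    have haQ : a ∈ Q := ha Q hQp fun h => hx0 (by simpa [h] using hxQ)
    obtain ⟨p', hp', hp'Q⟩ := Ideal.exists_minimalPrimes_le
      ((Ideal.span_singleton_le_iff_mem Q).mpr haQ)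
    have hp'p := hp'.isPrime
    have hlt' : p' < Q := lt_of_le_of_ne hp'Q fun h => hx p' hp' (h ▸ hxQ)
    have hbot : (⊥ : Ideal B) < p' := by
      refine bot_lt_iff_ne_bot.mpr fun h => ha0 ?_
      have : a ∈ p' := hp'.1.2 (Ideal.mem_span_singleton_self a)
      simpa [h] using this
    have h1 : Q.height ≤ 1 :=
      Ideal.height_le_one_of_isPrincipal_of_mem_minimalPrimes (Ideal.span {x}) Q hQ
    have h2 := Ideal.height_strict_mono_of_isPrime_of_isPrime hlt'
    have h3 := Ideal.height_strict_mono_of_isPrime_of_isPrime hbot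
    have h4 : p'.height < 1 := h2.trans_le h1
    rw [Order.lt_one_iff] at h4
    rw [h4] at h3
    exact not_lt_zero h3
  obtain ⟨M, hM⟩ := (Ideal.span {a}).exists_radical_pow_le_of_fg (IsNoetherian.noetherian _)
  exact ⟨M, (Ideal.pow_right_mono key M).trans hM⟩

/-- A decreasing chain of ideals whose quotients are spanned by one finite-dimensional space
stabilizes. -/
theorem Ideal.exists_forall_ge_eq_of_finiteDimensional {k R : Type*} [Field k] [CommRing R]
    [Algebra k R] (H : Submodule k R) [FiniteDimensional k H] (A : ℕ → Ideal R)
    (hA : Antitone A) (D : Ideal R) (hD : ∀ r, D ≤ A r) (hH : ∀ x, ∃ h ∈ H, x - h ∈ D) :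
    ∃ m, ∀ r, m ≤ r → A m = A r := by
  -- As `A r` contains `D`, it is determined by its intersection with `H`.
  obtain ⟨m, hm⟩ := IsArtinian.monotone_stabilizes (R := k) (M := H)
    ⟨fun r => OrderDual.toDual (((A r).restrictScalars k).comap H.subtype),
      fun r s hrs x hx => hA hrs hx⟩
  refine ⟨m, fun r hr => le_antisymm (fun x hx => ?_) (hA hr)⟩
  obtain ⟨h, hh, hxh⟩ := hH x
  have h1 : h ∈ A m := by
    have := (A m).sub_mem hx (hD m hxh)
    rwa [sub_sub_cancel] at this
  have h2 : (⟨h, hh⟩ : H) ∈ ((A m).restrictScalars k).comap H.subtype := h1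
  have h3 := hm r hr
  have h4 : (⟨h, hh⟩ : H) ∈ ((A r).restrictScalars k).comap H.subtype := by
    have h5 : ((A m).restrictScalars k).comap H.subtype =
      ((A r).restrictScalars k).comap H.subtype := h3
    rw [← h5]
    exact h2
  have h6 := (A r).add_mem (hD r hxh) (show h ∈ A r from h4)
  rwa [sub_add_cancel] at h6

section ValuationRing

variable {V : Type*} [CommRing V] [IsDomain V] [ValuationRing V] [Algebra ℂ V]

/-- A valuation ring over `ℂ` with a finite-dimensional quotient by a nonzero principal ideal
is discrete with residue field `ℂ`. -/
theorem ValuationRing.exists_uniformizer_of_finiteDimensional {α : V} (hα0 : α ≠ 0)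
    (hα : ¬ IsUnit α) (H : Submodule ℂ V) [FiniteDimensional ℂ H]
    (hH : ∀ v, ∃ h ∈ H, α ∣ v - h) :
    ∃ t : V, t ≠ 0 ∧ ¬ IsUnit t ∧ (∀ v, ∃ (c : ℂ) (w : V), v = algebraMap ℂ V c + t * w) ∧
      ∃ (u : V) (k : ℕ), IsUnit u ∧ α = u * t ^ k := by
  have hαm : α ∈ IsLocalRing.maximalIdeal V := (IsLocalRing.mem_maximalIdeal α).mpr hα
  have hres : ∀ v : V, ∃ c : ℂ, v - algebraMap ℂ V c ∈ IsLocalRing.maximalIdeal V := by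
    let ρ : H →ₗ[ℂ] V ⧸ IsLocalRing.maximalIdeal V :=
      (Ideal.Quotient.mkₐ ℂ (IsLocalRing.maximalIdeal V)).toLinearMap.comp H.subtype
    have hρ : Function.Surjective ρ := by
      intro x
      obtain ⟨v, rfl⟩ := Ideal.Quotient.mk_surjective x
      obtain ⟨h, hh, hd⟩ := hH v
      refine ⟨⟨h, hh⟩, ?_⟩
      refine (Ideal.Quotient.eq.mpr ?_).symm
      exact Ideal.mem_of_dvd _ hd hαm
    have : Module.Finite ℂ (V ⧸ IsLocalRing.maximalIdeal V) := Module.Finite.of_surjective ρ hρ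
    intro v
    obtain ⟨c, hc⟩ := (IsAlgClosed.algebraMap_bijective_of_isIntegral (k := ℂ)
      (K := V ⧸ IsLocalRing.maximalIdeal V)).2 (Ideal.Quotient.mk _ v)
    exact ⟨c, Ideal.Quotient.eq.mp hc.symm⟩
  -- Generated by `α` and a finite spanning set of its intersection with `H`; in a valuation ring it
  -- is then principal.
  have hfg : (IsLocalRing.maximalIdeal V).FG := by
    let H' : Submodule ℂ V := H ⊓ (IsLocalRing.maximalIdeal V).restrictScalars ℂ
    have hfin : FiniteDimensional ℂ H' := Submodule.finiteDimensional_inf_left _ _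
    obtain ⟨S, hS⟩ := Module.Finite.iff_fg.mp hfin
    have hSm : (S : Set V) ⊆ IsLocalRing.maximalIdeal V := fun x hx =>
      (show x ∈ H' from hS ▸ Submodule.subset_span hx).2
    refine Submodule.fg_def.mpr ⟨insert α S, S.finite_toSet.insert α, le_antisymm ?_ ?_⟩
    · exact Submodule.span_le.mpr (Set.insert_subset hαm hSm)
    · intro v hv
      obtain ⟨h, hh, hd⟩ := hH v
      have h1 : h ∈ H' := by
        refine ⟨hh, ?_⟩
        have := Ideal.sub_mem _ hv (Ideal.mem_of_dvd _ hd hαm)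
        rwa [sub_sub_cancel] at this
      rw [← hS] at h1
      have h2 : h ∈ Submodule.span V (insert α (S : Set V)) :=
        Submodule.span_mono (Set.subset_insert _ _) (Submodule.span_subset_span ℂ V _ h1)
      have h3 : v - h ∈ Submodule.span V (insert α (S : Set V)) :=
        Ideal.mem_of_dvd _ hd (Submodule.subset_span (Set.mem_insert _ _))
      have h4 := Submodule.add_mem _ h3 h2
      rwa [sub_add_cancel] at h4
  obtain ⟨t, ht⟩ := (IsBezout.isPrincipal_of_FG _ hfg).principal
  replace ht : IsLocalRing.maximalIdeal V = Ideal.span {t} := ht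
  have hdvd : ∀ v, v ∈ IsLocalRing.maximalIdeal V → t ∣ v := fun v hv =>
    Ideal.mem_span_singleton.mp (ht ▸ hv)
  have ht0 : t ≠ 0 := by
    rintro rfl
    exact hα0 (zero_dvd_iff.mp (hdvd α hαm))
  have htm : t ∈ IsLocalRing.maximalIdeal V := ht ▸ Ideal.mem_span_singleton_self t
  refine ⟨t, ht0, (IsLocalRing.mem_maximalIdeal t).mp htm, fun v => ?_, ?_⟩
  · obtain ⟨c, hc⟩ := hres v
    obtain ⟨w, hw⟩ := hdvd _ hc
    exact ⟨c, w, by rw [← hw, add_sub_cancel]⟩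
  -- The ideals `(t ^ r, α)` stabilize, so `α` divides some `t ^ m * (1 - t * x)`, whose last factor
  -- is a unit. For the least such exponent the cofactor is a unit.
  · have hpow : ∃ m, α ∣ t ^ m := by
      obtain ⟨m, hm⟩ := Ideal.exists_forall_ge_eq_of_finiteDimensional H
        (fun r => Ideal.span {t ^ r} ⊔ Ideal.span {α})
        (fun r s hrs => sup_le_sup_right (Ideal.span_singleton_le_span_singleton.mpr
          (pow_dvd_pow t hrs)) _) (Ideal.span {α}) (fun _ => le_sup_right)
        (fun x => by
          obtain ⟨h, hh, hd⟩ := hH x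
          exact ⟨h, hh, Ideal.mem_span_singleton.mpr hd⟩)
      have h1 : t ^ m ∈ Ideal.span {t ^ (m + 1)} ⊔ Ideal.span {α} := by
        rw [← hm (m + 1) (Nat.le_succ m)]
        exact Ideal.mem_sup_left (Ideal.mem_span_singleton_self _)
      obtain ⟨x, hx, y, hy, hxy⟩ := Submodule.mem_sup.mp h1
      obtain ⟨x, rfl⟩ := Ideal.mem_span_singleton.mp hx
      have h2 : IsUnit (1 - t * x) := by
        by_contra h
        have h3 := Ideal.add_mem _ ((IsLocalRing.mem_maximalIdeal _).mpr h)
          (Ideal.mul_mem_right x _ htm)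
        rw [sub_add_cancel] at h3
        exact (IsLocalRing.mem_maximalIdeal _).mp h3 isUnit_one
      refine ⟨m, h2.dvd_mul_right.mp ?_⟩
      have h4 : t ^ m * (1 - t * x) = y := by
        rw [mul_sub, mul_one, ← mul_assoc, ← pow_succ, sub_eq_iff_eq_add', hxy]
      rw [h4]
      exact Ideal.mem_span_singleton.mp hy
    classical
    obtain ⟨y, hy⟩ := Nat.find_spec hpow
    have hyu : IsUnit y := by
      by_contra h
      obtain ⟨y', rfl⟩ := hdvd y ((IsLocalRing.mem_maximalIdeal y).mpr h)
      have hpos : Nat.find hpow ≠ 0 := by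
        intro h0
        have h1 := Nat.find_spec hpow
        rw [h0, pow_zero] at h1
        exact hα (isUnit_of_dvd_one h1)
      refine Nat.find_min hpow (Nat.sub_one_lt hpos) ⟨y', mul_left_cancel₀ ht0 ?_⟩
      rw [← pow_succ', Nat.sub_one_add_one hpos, hy]
      ring
    obtain ⟨u, rfl⟩ := hyu
    refine ⟨((u⁻¹ : Vˣ) : V), Nat.find hpow, Units.isUnit _, ?_⟩
    rw [hy, mul_comm α, Units.inv_mul_cancel_left]

end ValuationRing

/-! ### Krull–Akizuki finiteness and the existence of arcs -/

namespace ConvergentPowerSeries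

variable {n : ℕ}

theorem exists_finiteDimensional_sub_mem_pow (n M : ℕ) :
    ∃ G : Submodule ℂ (ConvergentPowerSeries n), FiniteDimensional ℂ G ∧
      ∀ f, ∃ g ∈ G, f - g ∈ maxIdeal n ^ M := by
  induction M with
  | zero => exact ⟨⊥, inferInstance, fun f => ⟨0, Submodule.zero_mem _, by simp⟩⟩
  | succ M ih =>
    obtain ⟨G, hG, h⟩ := ih
    refine ⟨Submodule.span ℂ {1} ⊔ ⨆ i : Fin n, G.map (LinearMap.mulRight ℂ (coord i)),
      inferInstance, fun f => ?_⟩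
    obtain ⟨c, g, rfl⟩ := exists_eq_algebraMap_add_sum f
    choose g' hg' hd using fun i => h (g i)
    refine ⟨algebraMap ℂ _ c + ∑ i, g' i * coord i, Submodule.add_mem_sup ?_ ?_, ?_⟩
    · rw [Algebra.algebraMap_eq_smul_one]
      exact Submodule.smul_mem _ _ (Submodule.mem_span_singleton_self _)
    · exact sum_mem fun i _ => Submodule.mem_iSup_of_mem i ⟨g' i, hg' i, rfl⟩
    · rw [add_sub_add_left_eq_sub, ← Finset.sum_sub_distrib]
      refine sum_mem fun i _ => ?_
      rw [← sub_mul, pow_succ]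
      exact Ideal.mul_mem_mul (hd i) (Ideal.subset_span ⟨i, rfl⟩)

/-- The finiteness step of the Krull–Akizuki theorem. -/
theorem exists_finiteDimensional_dvd_sub {V : Type*} [CommRing V] [IsDomain V] [Algebra ℂ V]
    (φ : ConvergentPowerSeries n →ₐ[ℂ] V) {a : ConvergentPowerSeries n} (ha : φ a ≠ 0)
    (hφ : ∀ v, ∃ (r : ℕ) (b : ConvergentPowerSeries n), φ a ^ r * v = φ b) {M : ℕ}
    (hM : ∀ x ∈ maxIdeal n ^ M, ∃ y, φ x = φ a * φ y) :
    ∃ H : Submodule ℂ V, FiniteDimensional ℂ H ∧ ∀ v, ∃ h ∈ H, φ a ∣ v - h := by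
  classical
  have hMk : ∀ k, ∀ x ∈ maxIdeal n ^ (M * k), ∃ y, φ x = φ a ^ k * φ y := by
    intro k
    induction k with
    | zero => exact fun x _ => ⟨x, by simp⟩
    | succ k ih =>
      intro x hx
      rw [Nat.mul_succ, pow_add] at hx
      induction hx using Submodule.mul_induction_on' with
      | mem_mul_mem x hx y hy =>
        obtain ⟨x', hx'⟩ := ih x hx
        obtain ⟨y', hy'⟩ := hM y hy
        refine ⟨x' * y', ?_⟩
        rw [map_mul, map_mul, hx', hy']
        ring
      | add x _ y _ hx hy =>
        obtain ⟨x', hx'⟩ := hx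
        obtain ⟨y', hy'⟩ := hy
        exact ⟨x' + y', by rw [map_add, map_add, hx', hy', mul_add]⟩
  have hG : ∀ k, ∃ G : Submodule ℂ (ConvergentPowerSeries n), FiniteDimensional ℂ G ∧
      ∀ f, ∃ g ∈ G, ∃ y, φ f = φ g + φ a ^ k * φ y := by
    intro k
    obtain ⟨G, hG, h⟩ := exists_finiteDimensional_sub_mem_pow n (M * k)
    refine ⟨G, hG, fun f => ?_⟩
    obtain ⟨g, hg, hfg⟩ := h f
    obtain ⟨y, hy⟩ := hMk k _ hfg
    exact ⟨g, hg, y, by rw [← hy, map_sub, add_sub_cancel]⟩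
  -- The preimage under `φ` of `φ(a) φ(P)`.
  let D : Ideal (ConvergentPowerSeries n) := RingHom.ker φ ⊔ Ideal.span {a}
  have hD : ∀ x y, φ x = φ a * φ y → x ∈ D := by
    intro x y hxy
    have h1 : x - a * y ∈ RingHom.ker φ := by
      rw [RingHom.mem_ker, map_sub, map_mul, hxy, sub_self]
    rw [← sub_add_cancel x (a * y)]
    exact Submodule.add_mem_sup h1 (Ideal.mul_mem_right _ _ (Ideal.mem_span_singleton_self a))
  have hD' : ∀ x ∈ D, ∃ y, φ x = φ a * φ y := by
    intro x hx
    obtain ⟨z, hz, w, hw, rfl⟩ := Submodule.mem_sup.mp hx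
    obtain ⟨y, rfl⟩ := Ideal.mem_span_singleton.mp hw
    exact ⟨y, by rw [map_add, (RingHom.mem_ker).mp hz, zero_add, map_mul]⟩
  obtain ⟨G₁, hG₁, hG₁'⟩ := hG 1
  obtain ⟨m, hm⟩ := Ideal.exists_forall_ge_eq_of_finiteDimensional G₁
    (fun r => (Ideal.span {φ a ^ r}).comap φ ⊔ D)
    (fun r s hrs => sup_le_sup_right (Ideal.comap_mono
      (Ideal.span_singleton_le_span_singleton.mpr (pow_dvd_pow _ hrs))) _)
    D (fun _ => le_sup_right) (fun f => by
      obtain ⟨g, hg, y, hy⟩ := hG₁' f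
      refine ⟨g, hg, hD _ y ?_⟩
      rw [map_sub, hy, add_sub_cancel_left, pow_one])
  have hred : ∀ v, ∃ (b : ConvergentPowerSeries n) (w : V),
      φ a ^ m * v = φ b + φ a ^ (m + 1) * w := by
    intro v
    have hex : ∃ r, ∃ (b : ConvergentPowerSeries n) (w : V),
        φ a ^ r * v = φ b + φ a ^ (r + 1) * w := by
      obtain ⟨r, b, h⟩ := hφ v
      exact ⟨r, b, 0, by rw [h, mul_zero, add_zero]⟩
    obtain ⟨b, w, hbw⟩ := Nat.find_spec hex
    -- If the least exponent were `r + 1 > m`, stabilization would split `b` into a part mapped into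
    -- `φ(a) ^ (r + 2) V` and a part in `D`; cancelling one `φ(a)` gives exponent `r`.
    have hle : Nat.find hex ≤ m := by
      by_contra! hlt
      obtain ⟨r, hr⟩ : ∃ r, Nat.find hex = r + 1 := ⟨Nat.find hex - 1, by omega⟩
      refine Nat.find_min hex (m := r) (by omega) ?_
      rw [hr] at hbw
      have h1 : b ∈ (Ideal.span {φ a ^ (r + 1)}).comap φ ⊔ D := by
        refine Ideal.mem_sup_left (Ideal.mem_comap.mpr (Ideal.mem_span_singleton.mpr
          ⟨v - φ a * w, ?_⟩))
        rw [mul_sub, hbw]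
        ring
      rw [← hm (r + 1) (by omega), hm (r + 2) (by omega)] at h1
      obtain ⟨b₁, hb₁, b₂, hb₂, rfl⟩ := Submodule.mem_sup.mp h1
      obtain ⟨w', hw'⟩ := Ideal.mem_span_singleton.mp (Ideal.mem_comap.mp hb₁)
      obtain ⟨y, hy⟩ := hD' b₂ hb₂
      refine ⟨y, w' + w, mul_left_cancel₀ ha ?_⟩
      rw [map_add, hw', hy] at hbw
      rw [← mul_assoc, ← pow_succ', hbw]
      ring
    obtain ⟨e, he⟩ := Nat.exists_eq_add_of_le hle
    refine ⟨a ^ e * b, w, ?_⟩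
    rw [he, pow_add, mul_right_comm, hbw, map_mul, map_pow]
    ring
  obtain ⟨G, hGfin, hG'⟩ := hG (m + 1)
  have hinj : Function.Injective (LinearMap.mulLeft ℂ (φ a ^ m)) := fun x y h =>
    mul_left_cancel₀ (pow_ne_zero m ha) h
  -- Multiplication by `φ(a) ^ m` embeds this space into `φ(G)`.
  refine ⟨(G.map φ.toLinearMap).comap (LinearMap.mulLeft ℂ (φ a ^ m)),
    FiniteDimensional.of_injective ((LinearMap.mulLeft ℂ (φ a ^ m)).restrict
      (q := G.map φ.toLinearMap) fun x hx => hx) fun x y h => Subtype.ext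
        (hinj (congrArg Subtype.val h)), fun v => ?_⟩
  obtain ⟨b, w, h⟩ := hred v
  obtain ⟨g, hg, y, hy⟩ := hG' b
  have h1 : φ a ^ m * (v - φ a * (φ y + w)) = φ g := by
    rw [mul_sub, h, hy]
    ring
  exact ⟨v - φ a * (φ y + w), ⟨g, hg, h1.symm⟩, φ y + w, by ring⟩

/-- If `I` is generated by `F` and the elements of `I` whose derivatives lie in `I`, then `I` and
`F` have the same zero locus. -/
theorem le_radical_of_le_sup_derivIdeal {I F : Ideal (ConvergentPowerSeries n)}
    (hI : I ≤ maxIdeal n) (hIF : I ≤ F ⊔ derivIdeal I) : I ≤ F.radical := by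
  intro a haI
  by_contra haF
  obtain ⟨q, ⟨hFq, hqd⟩, hmax⟩ :=
    (wellFounded_gt (α := Ideal (ConvergentPowerSeries n))).has_min
    {p : Ideal (ConvergentPowerSeries n) | F ≤ p ∧
      Disjoint (p : Set (ConvergentPowerSeries n)) (Submonoid.powers a)}
    ⟨F, le_rfl, by
      rw [Set.disjoint_left]
      rintro _ hx ⟨k, rfl⟩
      exact haF ⟨k, hx⟩⟩
  replace hmax : ∀ J : Ideal (ConvergentPowerSeries n), q < J →
      ¬ Disjoint (J : Set (ConvergentPowerSeries n)) (Submonoid.powers a) :=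
    fun J hJ hd => hmax J ⟨hFq.trans hJ.le, hd⟩ hJ
  have hq : q.IsPrime := Ideal.isPrime_of_maximally_disjoint q _ hqd hmax
  have haq : a ∉ q := fun h => Set.disjoint_left.mp hqd h (Submonoid.mem_powers a)
  let B := ConvergentPowerSeries n ⧸ q
  let π : ConvergentPowerSeries n →ₐ[ℂ] B := Ideal.Quotient.mkₐ ℂ q
  have hπ : Function.Surjective π := Ideal.Quotient.mkₐ_surjective ℂ q
  have hπq : ∀ x, π x = 0 ↔ x ∈ q := fun x => Ideal.Quotient.eq_zero_iff_mem
  -- By maximality of `q`. Hence `π a` lies in every nonzero prime of `B`, and inverting it yields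
  -- the fraction field.
  have hpow : ∀ b : B, b ≠ 0 → ∃ k, b ∣ π a ^ k := by
    intro b hb
    obtain ⟨x, rfl⟩ := hπ b
    have hx : x ∉ q := fun h => hb ((hπq x).mpr h)
    obtain ⟨_, hy, k, rfl⟩ := Set.not_disjoint_iff.mp
      (hmax (q ⊔ Ideal.span {x}) (Submodule.lt_sup_iff_notMem.mpr hx))
    obtain ⟨z, hz, w, hw, hzw⟩ := Submodule.mem_sup.mp hy
    refine ⟨k, ?_⟩
    have h1 := congrArg π hzw
    rw [map_add, (hπq z).mpr hz, zero_add] at h1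
    simp only [map_pow] at h1
    rw [← h1]
    exact map_dvd π (Ideal.mem_span_singleton.mp hw)
  have : IsLocalRing B := IsLocalRing.of_surjective' (π : ConvergentPowerSeries n →+* B) hπ
  have hπa : π a ≠ 0 := fun h => haq ((hπq a).mp h)
  obtain ⟨M, hM⟩ := IsLocalRing.exists_maximalIdeal_pow_le_span hπa fun p hp hp0 => by
    obtain ⟨b, hb, hb0⟩ := Submodule.exists_mem_ne_zero_of_ne_bot hp0
    obtain ⟨k, hk⟩ := hpow b hb0
    exact hp.mem_of_pow_mem k (Ideal.mem_of_dvd _ hk hb)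
  -- A valuation ring of the fraction field dominating `B`; domination keeps `φ a` a nonunit.
  obtain ⟨A, hA, hloc⟩ := IsLocalRing.exists_factor_valuationRing (algebraMap B (FractionRing B))
  let ψ : B →+* A := (algebraMap B (FractionRing B)).codRestrict A.toSubring hA
  have hψ : Function.Injective ψ := fun x y h =>
    IsFractionRing.injective B (FractionRing B) (congrArg Subtype.val h)
  let _ : Algebra ℂ A := (ψ.comp (algebraMap ℂ B)).toAlgebra
  let φ : ConvergentPowerSeries n →ₐ[ℂ] A :=
    { ψ.comp (π : ConvergentPowerSeries n →+* B) with commutes' := fun c => rfl }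
  have hφ : ∀ x, φ x = ψ (π x) := fun x => rfl
  have hφa : φ a ≠ 0 := fun h => hπa (hψ (by rw [← hφ, h, map_zero]))
  have hφu : ¬ IsUnit (φ a) := by
    intro h
    have h1 : IsUnit (π a) := hloc.map_nonunit _ h
    obtain ⟨b, hb⟩ := h1.exists_right_inv
    obtain ⟨x, rfl⟩ := hπ b
    have h2 : a * x - 1 ∈ q := by
      rw [← hπq, map_sub, map_mul, hb, map_one, sub_self]
    have h3 : a * x - 1 ∈ maxIdeal n := by
      rw [maxIdeal_eq]
      exact IsLocalRing.le_maximalIdeal hq.ne_top h2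
    rw [mem_maxIdeal_iff, map_sub, map_mul, mem_maxIdeal_iff.mp (hI haI), map_one] at h3
    norm_num at h3
  obtain ⟨H, hH, hH'⟩ := exists_finiteDimensional_dvd_sub φ hφa
    (fun v => by
      obtain ⟨b, c, hc, hbc⟩ := IsFractionRing.div_surjective (A := B) (v : FractionRing B)
      have hc0 : c ≠ 0 := nonZeroDivisors.ne_zero hc
      obtain ⟨k, d, hd⟩ := hpow c hc0
      obtain ⟨x, hx⟩ := hπ (d * b)
      refine ⟨k, x, Subtype.ext ?_⟩
      have hc' : algebraMap B (FractionRing B) c ≠ 0 := by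
        simpa using hc0
      have h1 : ((φ a ^ k * v : A) : FractionRing B) =
          algebraMap B (FractionRing B) (π a ^ k) * v := by
        rw [map_pow]
        rfl
      have h2 : ((φ x : A) : FractionRing B) = algebraMap B (FractionRing B) (π x) := rfl
      rw [h1, h2, hx, hd, ← hbc, map_mul, map_mul]
      rw [mul_right_comm, mul_comm (algebraMap B (FractionRing B) c), div_mul_cancel₀ _ hc',
        mul_comm])
    (M := M) (fun x hx => by
      have h1 : π x ∈ IsLocalRing.maximalIdeal B ^ M := by
        have h2 : Ideal.map π (maxIdeal n ^ M) ≤ IsLocalRing.maximalIdeal B ^ M := by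
          rw [Ideal.map_pow]
          refine Ideal.pow_right_mono (IsLocalRing.le_maximalIdeal fun h => ?_) M
          rw [Ideal.eq_top_iff_one, Ideal.mem_map_iff_of_surjective π hπ] at h
          obtain ⟨y, hy, hy1⟩ := h
          have h3 : y - 1 ∈ q := by rw [← hπq, map_sub, hy1, map_one, sub_self]
          have h4 : y - 1 ∈ maxIdeal n := by
            rw [maxIdeal_eq]
            exact IsLocalRing.le_maximalIdeal hq.ne_top h3
          rw [mem_maxIdeal_iff, map_sub, mem_maxIdeal_iff.mp hy, map_one] at h4
          norm_num at h4
        exact h2 (Ideal.mem_map_of_mem π hx)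
      obtain ⟨b, hb⟩ := Ideal.mem_span_singleton.mp (hM h1)
      obtain ⟨y, rfl⟩ := hπ b
      exact ⟨y, by rw [hφ, hb, map_mul]; rfl⟩)
  obtain ⟨t, ht0, ht, hV, u, k, hu, hau⟩ :=
    ValuationRing.exists_uniformizer_of_finiteDimensional hφa hφu H hH'
  refine false_of_arc φ ht0 ht hV hI hIF (fun f hf => ?_) haI hu hau
  rw [hφ, (hπq f).mpr (hFq hf), map_zero]

/-! ### The quotient `I/(J + 𝔪I)` and Nakayama's lemma -/

theorem smul_obstructionQuotient_eq_zero {I : Ideal (ConvergentPowerSeries n)}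
    {f : ConvergentPowerSeries n} (hf : f ∈ maxIdeal n) (x : ObstructionQuotient I) :
    f • x = 0 := by
  obtain ⟨y, rfl⟩ := Submodule.Quotient.mk_surjective _ x
  rw [← Submodule.Quotient.mk_smul, Submodule.Quotient.mk_eq_zero]
  exact Ideal.mem_sup_right (Ideal.mul_mem_mul hf y.2)

/-- Since `𝔪` acts by zero and `P = ℂ + 𝔪`, the complex span of module generators is already a
submodule. -/
theorem finiteDimensional_obstructionQuotient (I : Ideal (ConvergentPowerSeries n)) :
    FiniteDimensional ℂ (ObstructionQuotient I) := by
  obtain ⟨S, hS⟩ :=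
    IsNoetherian.noetherian (⊤ : Submodule (ConvergentPowerSeries n) (ObstructionQuotient I))
  let W : Submodule (ConvergentPowerSeries n) (ObstructionQuotient I) :=
    { Submodule.span ℂ (S : Set (ObstructionQuotient I)) with
      smul_mem' := fun f x hx => by
        have h1 := smul_obstructionQuotient_eq_zero (sub_algebraMap_mem_maxIdeal f) x
        rw [sub_smul, sub_eq_zero, algebraMap_smul] at h1
        rw [h1]
        exact Submodule.smul_mem _ _ hx }
  have hW : Submodule.span (ConvergentPowerSeries n) (S : Set (ObstructionQuotient I)) ≤ W :=
    Submodule.span_le.mpr Submodule.subset_span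
  refine Module.finite_def.mpr ⟨S, eq_top_iff.mpr fun x _ => ?_⟩
  exact hW (hS ▸ Submodule.mem_top : x ∈ Submodule.span _ _)

theorem exists_ideal_le_sup_derivIdeal (I : Ideal (ConvergentPowerSeries n)) :
    ∃ s : Finset (ConvergentPowerSeries n), (s : Set (ConvergentPowerSeries n)) ⊆ I ∧
      s.card ≤ Module.finrank ℂ (ObstructionQuotient I) ∧
      I ≤ Ideal.span (s : Set (ConvergentPowerSeries n)) ⊔ derivIdeal I := by
  classical
  have := finiteDimensional_obstructionQuotient I
  let b := Module.finBasis ℂ (ObstructionQuotient I)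
  choose f hf using fun i => Submodule.Quotient.mk_surjective _ (b i)
  let s : Finset (ConvergentPowerSeries n) := Finset.univ.image fun i => (f i).1
  refine ⟨s, ?_, ?_, ?_⟩
  · intro x hx
    obtain ⟨i, -, rfl⟩ := Finset.mem_image.mp hx
    exact (f i).2
  · exact Finset.card_image_le.trans (by simp)
  -- Nakayama: it suffices that `I` lies in `(s) + J + 𝔪I`, which is read off from coordinates in
  -- the basis.
  · refine Submodule.le_of_le_smul_of_le_jacobson_bot (I := maxIdeal n)
      (IsNoetherian.noetherian I) ?_ fun g hg => ?_
    · rw [maxIdeal_eq]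
      exact IsLocalRing.maximalIdeal_le_jacobson _
    · have h1 := b.sum_repr (Submodule.Quotient.mk ⟨g, hg⟩)
      set c := b.repr (Submodule.Quotient.mk ⟨g, hg⟩)
      have h2 : (⟨g, hg⟩ - ∑ i, c i • f i : I) ∈
          (derivIdeal I ⊔ maxIdeal n * I).submoduleOf I := by
        rw [← Submodule.Quotient.mk_eq_zero, Submodule.Quotient.mk_sub, ← h1, sub_eq_zero]
        have h3 : ∀ x, (Submodule.Quotient.mk x : ObstructionQuotient I) =
          (Submodule.mkQ _).restrictScalars ℂ x := fun _ => rfl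
        rw [h3 (∑ i, c i • f i), map_sum]
        refine Finset.sum_congr rfl fun i _ => ?_
        rw [map_smul, ← h3, hf]
      have h4 : g - ∑ i, c i • (f i).1 ∈ derivIdeal I ⊔ maxIdeal n * I := by
        have h5 : ((⟨g, hg⟩ - ∑ i, c i • f i : I) : ConvergentPowerSeries n) ∈
          derivIdeal I ⊔ maxIdeal n * I := h2
        simpa using h5
      have h6 : ∑ i, c i • (f i).1 ∈ Ideal.span (s : Set (ConvergentPowerSeries n)) :=
        sum_mem fun i _ => Submodule.smul_of_tower_mem _ _ (Ideal.subset_span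
          (Finset.mem_coe.mpr (Finset.mem_image_of_mem _ (Finset.mem_univ i))))
      rw [sup_assoc, smul_eq_mul, ← sub_add_cancel g (∑ i, c i • (f i).1), add_comm]
      exact Submodule.add_mem_sup h6 h4

end ConvergentPowerSeries

/-! ### The dimension inequality -/

theorem ringKrullDim_quotient_le_of_le_radical {R : Type*} [CommRing R] {I F : Ideal R}
    (h : I ≤ F.radical) : ringKrullDim (R ⧸ F) ≤ ringKrullDim (R ⧸ I) := by
  have h1 : ringKrullDim (R ⧸ F) = ringKrullDim (R ⧸ F.radical) := by
    rw [ringKrullDim_quotient, ringKrullDim_quotient, PrimeSpectrum.zeroLocus_radical]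
  rw [h1]
  exact ringKrullDim_le_of_surjective (Ideal.Quotient.factor h) (Ideal.Quotient.factor_surjective h)

theorem theoremV4p28 (n : ℕ) (hn : 0 < n) (I : Ideal (ConvergentPowerSeries n)) (hI : I ≠ ⊤) :
    FiniteDimensional ℂ (ConvergentPowerSeries.ObstructionQuotient I) ∧
      (n : WithBot ℕ∞) ≤ ringKrullDim (ConvergentPowerSeries n ⧸ I) +
        (Module.finrank ℂ (ConvergentPowerSeries.ObstructionQuotient I) : WithBot ℕ∞) := by
  refine ⟨ConvergentPowerSeries.finiteDimensional_obstructionQuotient I, ?_⟩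
  have hIm : I ≤ ConvergentPowerSeries.maxIdeal n := by
    rw [ConvergentPowerSeries.maxIdeal_eq]
    exact IsLocalRing.le_maximalIdeal hI
  obtain ⟨s, hsI, hcard, hs⟩ := ConvergentPowerSeries.exists_ideal_le_sup_derivIdeal I
  have hrad := ConvergentPowerSeries.le_radical_of_le_sup_derivIdeal hIm hs
  -- Elements of the Jacobson radical each lower the dimension by at most one.
  have hjac : (s : Set (ConvergentPowerSeries n)) ⊆ Ring.jacobson (ConvergentPowerSeries n) := by
    rw [IsLocalRing.ringJacobson_eq_maximalIdeal, ← ConvergentPowerSeries.maxIdeal_eq]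
    exact hsI.trans hIm
  calc (n : WithBot ℕ∞) ≤ ringKrullDim (ConvergentPowerSeries n) :=
        ConvergentPowerSeries.le_ringKrullDim n
    _ ≤ ringKrullDim (ConvergentPowerSeries n ⧸
          Ideal.span (s : Set (ConvergentPowerSeries n))) + s.card :=
        ringKrullDim_le_ringKrullDim_quotient_add_card s hjac
    _ ≤ _ := by
        gcongr
        exact ringKrullDim_quotient_le_of_le_radical hrad
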